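/- Let $\mathbf{k}$ be a field of characteristic $0$ and let $P$ be a linear operad over $\mathbf{k}$ (symmetric, with identity; $P(S)$ is an arbitrary vector space for every finite set $S$, including $S=\emptyset$). Let $\mathbf{V}$ and $\mathbf{V}_n$ ($n\ge 0$) be the free $P$-algebras on the generators $x_1,x_2,\dots$ and $x_1,\dots,x_n$ respectively. Let $\mathfrak{h}_n$ be the Lie algebra of all derivations of the $P$-algebra $\mathbf{V}_n$, regarded as derivations of $\mathbf{V}$ that kill $x_i$ for $i>n$, and let $\mathfrak{h}=\bigcup_n \mathfrak{h}_n$, i.e. the Lie algebra of derivations of $\mathbf{V}$ that kill all but finitely many of the $x_i$. A representation of $\mathfrak{h}$ (respectively $\mathfrak{h}_n$) is called polynomial if it is isomorphic to a subquotient of a (possibly infinite) direct sum of tensor powers $\mathbf{V}^{\otimes d}$ (respectively $\mathbf{V}_n^{\otimes d}$), $d\ge 0$; write $\mathrm{Rep}^{\mathrm{pol}}(\mathfrak{h})$ and $\mathrm{Rep}^{\mathrm{pol}}(\mathfrak{h}_n)$ for the full subcategories of polynomial representations. Let $\mathfrak{gl}_{\infty-n}\subset\mathfrak{h}$ be the Lie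 subalgebra of those derivations in $\mathfrak{h}$ that kill $x_1,\dots,x_n$ and send each $x_i$ with $i>n$ to a linear combination of the $x_j$ with $j>n$; it commutes with $\mathfrak{h}_n$, so that for an $\mathfrak{h}$-module $M$ the space of invariants $\Gamma_n(M)=M^{\mathfrak{gl}_{\infty-n}}$ is an $\mathfrak{h}_n$-module. Proposition. For every $n\ge 0$, if $M$ is a polynomial $\mathfrak{h}$-module then $\Gamma_n(M)$ is a polynomial $\mathfrak{h}_n$-module, and the resulting specialization functor $$\Gamma_n\colon \mathrm{Rep}^{\mathrm{pol}}(\mathfrak{h})\to\mathrm{Rep}^{\mathrm{pol}}(\mathfrak{h}_n)$$ is essentially surjective: every polynomial $\mathfrak{h}_n$-module is isomorphic to $\Gamma_n(M)$ for some polynomial $\mathfrak{h}$-module $M$. -/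

import Mathlib

open CategoryTheory

universe u

noncomputable section

namespace OperadRep

/-! ### Linear operads -/

/-- A (symmetric, unital) linear operad over `k`, in coordinate-free form: a functor `obj` from
finite sets and bijections to `k`-vector spaces, with composition maps
`P(T) ⊗ ⨂_{t ∈ T} P(S t) → P(⨆_{t ∈ T} S t)` (the target is the disjoint union) and an identity
operation, subject to equivariance, associativity and the two identity axioms. -/
structure LinearOperad (k : Type u) [Field k] where
  /-- the space of operations with inputs labelled by the finite set `S` -/
  obj : (S : Type) → [Finite S] → Type u
  [addCommGroup : ∀ (S : Type) [Finite S], AddCommGroup (obj S)]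
  [module : ∀ (S : Type) [Finite S], Module k (obj S)]
  /-- relabelling of the inputs along a bijection -/
  map : ∀ {S T : Type} [Finite S] [Finite T], S ≃ T → (obj S →ₗ[k] obj T)
  map_refl : ∀ {S : Type} [Finite S] (p : obj S), map (Equiv.refl S) p = p
  map_trans : ∀ {S T U : Type} [Finite S] [Finite T] [Finite U] (e : S ≃ T) (f : T ≃ U)
    (p : obj S), map (e.trans f) p = map f (map e p)
  /-- composition of operations, linear in each argument -/
  comp : ∀ {T : Type} [Finite T] {S : T → Type} [∀ t, Finite (S t)],
    obj T →ₗ[k] MultilinearMap k (fun t => obj (S t)) (obj (Σ t, S t))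
  /-- the identity operation -/
  one : obj Unit
  comp_map_inner : ∀ {T : Type} [Finite T] {S S' : T → Type} [∀ t, Finite (S t)]
    [∀ t, Finite (S' t)] (e : ∀ t, S t ≃ S' t) (p : obj T) (q : ∀ t, obj (S t)),
    comp p (fun t => map (e t) (q t)) = map (Equiv.sigmaCongrRight e) (comp p q)
  comp_map_outer : ∀ {T T' : Type} [Finite T] [Finite T'] {S : T' → Type} [∀ t, Finite (S t)]
    (e : T ≃ T') (p : obj T) (q : ∀ t, obj (S t)),
    comp (map e p) q = map (Equiv.sigmaCongrLeft e) (comp p (fun t => q (e t)))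
  comp_assoc : ∀ {T : Type} [Finite T] {S : T → Type} [∀ t, Finite (S t)]
    {R : ∀ t, S t → Type} [∀ t s, Finite (R t s)]
    (p : obj T) (q : ∀ t, obj (S t)) (r : ∀ t s, obj (R t s)),
    map (Equiv.sigmaAssoc R)
        (comp (S := fun x : (Σ t, S t) => R x.1 x.2) (comp p q) (fun x => r x.1 x.2)) =
      comp p (fun t => comp (q t) (r t))
  one_comp : ∀ {S : Type} [Finite S] (p : obj S),
    map (Equiv.uniqueSigma (fun _ : Unit => S)) (comp one (fun _ => p)) = p
  comp_one : ∀ {T : Type} [Finite T] (p : obj T),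
    map (Equiv.sigmaUnique T (fun _ => Unit)) (comp p (fun _ => one)) = p

attribute [instance] LinearOperad.addCommGroup LinearOperad.module

variable {k : Type u} [Field k]

/-! ### Algebras over an operad -/

/-- The structure of a `P`-algebra on a `k`-vector space `A`. -/
class OperadAlgebra (P : LinearOperad k) (A : Type*) [AddCommGroup A] [Module k A] where
  /-- the operation `(a₁, …, a_r) ↦ p(a₁, …, a_r)` given by `p ∈ P([r])` -/
  act : ∀ {r : ℕ}, P.obj (Fin r) →ₗ[k] MultilinearMap k (fun _ : Fin r => A) A
  act_map : ∀ {r : ℕ} (σ : Fin r ≃ Fin r) (p : P.obj (Fin r)) (a : Fin r → A),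
    act (P.map σ p) a = act p (fun i => a (σ i))
  act_comp : ∀ {r : ℕ} {s : Fin r → ℕ} (p : P.obj (Fin r)) (q : ∀ i, P.obj (Fin (s i)))
    (a : Fin (∑ i, s i) → A),
    act (P.map finSigmaFinEquiv (P.comp p q)) a =
      act p (fun i => act (q i) (fun j => a (finSigmaFinEquiv ⟨i, j⟩)))
  act_one : ∀ a : Fin 1 → A, act (P.map (Equiv.ofUnique Unit (Fin 1)) P.one) a = a 0

section Algebra

variable (P : LinearOperad k)
variable {A : Type*} [AddCommGroup A] [Module k A] [OperadAlgebra P A]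
variable {B : Type*} [AddCommGroup B] [Module k B] [OperadAlgebra P B]

/-- `p(a₁, …, a_r)`. -/
def act {r : ℕ} (p : P.obj (Fin r)) : MultilinearMap k (fun _ : Fin r => A) A :=
  OperadAlgebra.act p

/-- A linear map between `P`-algebras is a homomorphism if it commutes with all operations. -/
def IsHom (f : A →ₗ[k] B) : Prop :=
  ∀ (r : ℕ) (p : P.obj (Fin r)) (a : Fin r → A), f (act P p a) = act P p (fun i => f (a i))

/-- `D` is a derivation along the map `f` (the Leibniz rule). -/
def IsDerivationAlong (f D : A →ₗ[k] B) : Prop :=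
  ∀ (r : ℕ) (p : P.obj (Fin r)) (a : Fin r → A),
    D (act P p a) = ∑ i, act P p (Function.update (fun j => f (a j)) i (D (a i)))

/-- `δ` is a derivation of the `P`-algebra `A`:
`δ(p(a₁, …, a_r)) = ∑ i, p(a₁, …, δ(a_i), …, a_r)`. -/
def IsDerivation (δ : A →ₗ[k] A) : Prop :=
  ∀ (r : ℕ) (p : P.obj (Fin r)) (a : Fin r → A),
    δ (act P p a) = ∑ i, act P p (Function.update a i (δ (a i)))

end Algebra

/-! ### The free algebra -/

/-- Formal expressions in the generators `x ∈ X` built from the vector space operations and the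
operations of `P`. -/
inductive Pre (P : LinearOperad k) (X : Type) : Type u
  | gen (x : X) : Pre P X
  | zero : Pre P X
  | add (a b : Pre P X) : Pre P X
  | smul (c : k) (a : Pre P X) : Pre P X
  | op (r : ℕ) (p : P.obj (Fin r)) (a : Fin r → Pre P X) : Pre P X

/-- The congruence generated by the axioms of a `P`-algebra. -/
inductive Rel (P : LinearOperad k) (X : Type) : Pre P X → Pre P X → Prop
  | refl (a) : Rel P X a a
  | symm {a b} : Rel P X a b → Rel P X b a
  | trans {a b c} : Rel P X a b → Rel P X b c → Rel P X a c
  | add_congr {a a' b b'} : Rel P X a a' → Rel P X b b' → Rel P X (a.add b) (a'.add b')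
  | smul_congr (c : k) {a a'} : Rel P X a a' → Rel P X (a.smul c) (a'.smul c)
  | op_congr {r : ℕ} (p : P.obj (Fin r)) {a a' : Fin r → Pre P X} :
      (∀ i, Rel P X (a i) (a' i)) → Rel P X (.op r p a) (.op r p a')
  -- the axioms of a vector space
  | add_assoc (a b c : Pre P X) : Rel P X ((a.add b).add c) (a.add (b.add c))
  | add_comm (a b : Pre P X) : Rel P X (a.add b) (b.add a)
  | zero_add (a : Pre P X) : Rel P X (Pre.zero.add a) a
  | neg_add (a : Pre P X) : Rel P X ((a.smul (-1)).add a) .zero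
  | smul_add (c : k) (a b : Pre P X) : Rel P X ((a.add b).smul c) ((a.smul c).add (b.smul c))
  | add_smul (c d : k) (a : Pre P X) : Rel P X (a.smul (c + d)) ((a.smul c).add (a.smul d))
  | mul_smul (c d : k) (a : Pre P X) : Rel P X (a.smul (c * d)) ((a.smul d).smul c)
  | one_smul (a : Pre P X) : Rel P X (a.smul 1) a
  -- linearity of `p(a₁, …, a_r)` in `p` and in each `a_i`
  | op_add_left {r : ℕ} (p q : P.obj (Fin r)) (a : Fin r → Pre P X) :
      Rel P X (.op r (p + q) a) ((Pre.op r p a).add (.op r q a))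
  | op_smul_left {r : ℕ} (c : k) (p : P.obj (Fin r)) (a : Fin r → Pre P X) :
      Rel P X (.op r (c • p) a) ((Pre.op r p a).smul c)
  | op_add {r : ℕ} (p : P.obj (Fin r)) (a : Fin r → Pre P X) (i : Fin r) (b c : Pre P X) :
      Rel P X (.op r p (Function.update a i (b.add c)))
        ((Pre.op r p (Function.update a i b)).add (.op r p (Function.update a i c)))
  | op_smul {r : ℕ} (p : P.obj (Fin r)) (a : Fin r → Pre P X) (i : Fin r) (c : k) (b : Pre P X) :
      Rel P X (.op r p (Function.update a i (b.smul c)))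
        ((Pre.op r p (Function.update a i b)).smul c)
  -- equivariance, associativity and identity
  | op_map {r : ℕ} (σ : Fin r ≃ Fin r) (p : P.obj (Fin r)) (a : Fin r → Pre P X) :
      Rel P X (.op r (P.map σ p) a) (.op r p (fun i => a (σ i)))
  | op_comp {r : ℕ} {s : Fin r → ℕ} (p : P.obj (Fin r)) (q : ∀ i, P.obj (Fin (s i)))
      (a : Fin (∑ i, s i) → Pre P X) :
      Rel P X (.op _ (P.map finSigmaFinEquiv (P.comp p q)) a)
        (.op r p (fun i => .op (s i) (q i) (fun j => a (finSigmaFinEquiv ⟨i, j⟩))))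
  | op_one (a : Fin 1 → Pre P X) :
      Rel P X (.op 1 (P.map (Equiv.ofUnique Unit (Fin 1)) P.one) a) (a 0)

/-- The setoid of the congruence `Rel`. -/
def relSetoid (P : LinearOperad k) (X : Type) : Setoid (Pre P X) where
  r := Rel P X
  iseqv := ⟨Rel.refl, Rel.symm, Rel.trans⟩

/-- The free `P`-algebra on the set `X`, that is, the free `P`-algebra `P{W}` on the vector space
`W` with basis `X`. Its universal property is `lift_gen`, `lift_isHom`, `hom_unique` below. -/
def FreeAlg (P : LinearOperad k) (X : Type) : Type u := Quotient (relSetoid P X)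

namespace FreeAlg

variable {P : LinearOperad k} {X : Type}

/-- The class of a formal expression. -/
def mk (a : Pre P X) : FreeAlg P X := Quotient.mk (relSetoid P X) a

theorem mk_eq {a b : Pre P X} (h : Rel P X a b) : mk a = mk b :=
  Quotient.sound (s := relSetoid P X) h

theorem rel_of_mk_eq {a b : Pre P X} (h : mk a = mk b) : Rel P X a b :=
  Quotient.exact (s := relSetoid P X) h

theorem mk_surj (v : FreeAlg P X) : ∃ a, mk a = v := Quotient.exists_rep v

/-- A representative of a class. -/
def rep (v : FreeAlg P X) : Pre P X := (mk_surj v).choose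

theorem mk_rep (v : FreeAlg P X) : mk (rep v) = v := (mk_surj v).choose_spec

instance : Zero (FreeAlg P X) := ⟨mk .zero⟩
instance : Add (FreeAlg P X) := ⟨fun v w => mk ((rep v).add (rep w))⟩
instance : SMul k (FreeAlg P X) := ⟨fun c v => mk ((rep v).smul c)⟩
instance : Neg (FreeAlg P X) := ⟨fun v => (-1 : k) • v⟩

theorem mk_zero : mk (.zero : Pre P X) = 0 := rfl

theorem mk_add (a b : Pre P X) : mk (a.add b) = mk a + mk b :=
  mk_eq (.add_congr (rel_of_mk_eq (mk_rep _).symm) (rel_of_mk_eq (mk_rep _).symm))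

theorem mk_smul (c : k) (a : Pre P X) : mk (a.smul c) = c • mk a :=
  mk_eq (.smul_congr c (rel_of_mk_eq (mk_rep _).symm))

instance : AddCommGroup (FreeAlg P X) where
  add_assoc u v w := by
    obtain ⟨a, rfl⟩ := mk_surj u
    obtain ⟨b, rfl⟩ := mk_surj v
    obtain ⟨c, rfl⟩ := mk_surj w
    simp only [← mk_add]
    exact mk_eq (.add_assoc a b c)
  zero_add u := by
    obtain ⟨a, rfl⟩ := mk_surj u
    rw [← mk_zero, ← mk_add]
    exact mk_eq (.zero_add a)
  add_zero u := by
    obtain ⟨a, rfl⟩ := mk_surj u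
    rw [← mk_zero, ← mk_add]
    exact mk_eq (.trans (.add_comm a _) (.zero_add a))
  add_comm u v := by
    obtain ⟨a, rfl⟩ := mk_surj u
    obtain ⟨b, rfl⟩ := mk_surj v
    simp only [← mk_add]
    exact mk_eq (.add_comm a b)
  neg_add_cancel u := by
    obtain ⟨a, rfl⟩ := mk_surj u
    change (-1 : k) • mk a + mk a = 0
    rw [← mk_smul, ← mk_add]
    exact mk_eq (.neg_add a)
  nsmul := nsmulRec
  zsmul := zsmulRec

instance : Module k (FreeAlg P X) where
  one_smul u := by
    obtain ⟨a, rfl⟩ := mk_surj u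
    rw [← mk_smul]
    exact mk_eq (.one_smul a)
  mul_smul c d u := by
    obtain ⟨a, rfl⟩ := mk_surj u
    simp only [← mk_smul]
    exact mk_eq (.mul_smul c d a)
  smul_add c u v := by
    obtain ⟨a, rfl⟩ := mk_surj u
    obtain ⟨b, rfl⟩ := mk_surj v
    simp only [← mk_smul, ← mk_add]
    exact mk_eq (.smul_add c a b)
  add_smul c d u := by
    obtain ⟨a, rfl⟩ := mk_surj u
    simp only [← mk_smul, ← mk_add]
    exact mk_eq (.add_smul c d a)
  smul_zero c := by
    have h : c • (0 : FreeAlg P X) + c • (0 : FreeAlg P X) = c • (0 : FreeAlg P X) := by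
      conv_rhs => rw [← add_zero (0 : FreeAlg P X)]
      rw [← mk_zero, ← mk_add]
      simp only [← mk_smul, ← mk_add]
      exact mk_eq (.symm (.smul_add c _ _))
    simpa using h
  zero_smul u := by
    obtain ⟨a, rfl⟩ := mk_surj u
    have h : (0 : k) • mk a + (0 : k) • mk a = (0 : k) • mk a := by
      conv_rhs => rw [← add_zero (0 : k)]
      simp only [← mk_smul, ← mk_add]
      exact mk_eq (.symm (.add_smul 0 0 a))
    simpa using h

/-- The operation of `p` on classes. -/
def opFun {r : ℕ} (p : P.obj (Fin r)) (v : Fin r → FreeAlg P X) : FreeAlg P X :=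
  mk (.op r p (fun i => rep (v i)))

theorem opFun_mk {r : ℕ} (p : P.obj (Fin r)) (a : Fin r → Pre P X) :
    opFun p (fun i => mk (a i)) = mk (.op r p a) :=
  mk_eq (.op_congr p (fun _ => rel_of_mk_eq (mk_rep _)))

theorem opFun_update {r : ℕ} (p : P.obj (Fin r)) (v : Fin r → FreeAlg P X) (i : Fin r)
    (b : Pre P X) :
    opFun p (Function.update v i (mk b)) =
      mk (.op r p (Function.update (fun j => rep (v j)) i b)) := by
  rw [← opFun_mk]
  congr 1
  funext j
  by_cases h : j = i
  · subst h; simp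
  · simp [h, mk_rep]

instance : OperadAlgebra P (FreeAlg P X) where
  act {r} :=
    { toFun := fun p => MultilinearMap.mk' (opFun p)
        (fun v i b c => by
          obtain ⟨b, rfl⟩ := mk_surj b
          obtain ⟨c, rfl⟩ := mk_surj c
          rw [← mk_add]
          simp only [opFun_update]
          rw [← mk_add]
          exact mk_eq (.op_add p _ i b c))
        (fun v i c b => by
          obtain ⟨b, rfl⟩ := mk_surj b
          rw [← mk_smul]
          simp only [opFun_update]
          rw [← mk_smul]
          exact mk_eq (.op_smul p _ i c b))
      map_add' := fun p q => by
        ext v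
        change opFun (p + q) v = opFun p v + opFun q v
        unfold opFun
        rw [← mk_add]
        exact mk_eq (.op_add_left p q _)
      map_smul' := fun c p => by
        ext v
        change opFun (c • p) v = c • opFun p v
        unfold opFun
        rw [← mk_smul]
        exact mk_eq (.op_smul_left c p _) }
  act_map {r} σ p v := mk_eq (.op_map σ p _)
  act_comp {r s} p q v := by
    change opFun _ v = opFun p (fun i => opFun (q i) _)
    unfold opFun
    refine mk_eq (.trans (.op_comp p q _) (.op_congr p (fun i => ?_)))
    exact rel_of_mk_eq (mk_rep _).symm
  act_one v := by
    change opFun _ v = v 0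
    unfold opFun
    refine (mk_eq (.op_one _)).trans (mk_rep _)

theorem act_mk {r : ℕ} (p : P.obj (Fin r)) (a : Fin r → Pre P X) :
    act P p (fun i => mk (a i)) = mk (.op r p a) :=
  opFun_mk p a

/-- The generators `x_i` of the free algebra. -/
def gen (P : LinearOperad k) {X : Type} (x : X) : FreeAlg P X := mk (.gen x)

/-- Induction principle: the free algebra is generated by the `x_i`. -/
theorem induct {C : FreeAlg P X → Prop} (hgen : ∀ x, C (gen P x)) (hzero : C 0)
    (hadd : ∀ v w, C v → C w → C (v + w)) (hsmul : ∀ (c : k) v, C v → C (c • v))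
    (hop : ∀ (r : ℕ) (p : P.obj (Fin r)) (v : Fin r → FreeAlg P X), (∀ i, C (v i)) →
      C (act P p v)) (v : FreeAlg P X) : C v := by
  obtain ⟨a, rfl⟩ := mk_surj v
  induction a with
  | gen x => exact hgen x
  | zero => exact hzero
  | add a b ha hb => rw [mk_add]; exact hadd _ _ ha hb
  | smul c a ha => rw [mk_smul]; exact hsmul _ _ ha
  | op r p a ha => rw [← act_mk]; exact hop _ _ _ ha

section Lift

variable {B : Type*} [AddCommGroup B] [Module k B] [OperadAlgebra P B]

/-- Evaluation of formal expressions in a `P`-algebra. -/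
def preLift (f : X → B) : Pre P X → B
  | .gen x => f x
  | .zero => 0
  | .add a b => preLift f a + preLift f b
  | .smul c a => c • preLift f a
  | .op _ p a => act P p (fun i => preLift f (a i))

theorem preLift_update (f : X → B) {r : ℕ} (a : Fin r → Pre P X) (i : Fin r) (b : Pre P X) :
    (fun j => preLift f (Function.update a i b j)) =
      Function.update (fun j => preLift f (a j)) i (preLift f b) := by
  funext j
  by_cases h : j = i
  · subst h; simp
  · simp [h]

theorem preLift_rel (f : X → B) {a b : Pre P X} (h : Rel P X a b) :
    preLift f a = preLift f b := by
  induction h with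
  | refl => rfl
  | symm _ ih => exact ih.symm
  | trans _ _ ih1 ih2 => exact ih1.trans ih2
  | add_congr _ _ ih1 ih2 => simp only [preLift, ih1, ih2]
  | smul_congr c _ ih => simp only [preLift, ih]
  | op_congr p _ ih => simp only [preLift, ih]
  | add_assoc a b c => simp only [preLift, add_assoc]
  | add_comm a b => simp only [preLift, add_comm]
  | zero_add a => simp only [preLift, zero_add]
  | neg_add a => simp [preLift]
  | smul_add c a b => simp only [preLift, smul_add]
  | add_smul c d a => simp only [preLift, add_smul]
  | mul_smul c d a => simp only [preLift, mul_smul]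
  | one_smul a => simp only [preLift, one_smul]
  | op_add_left p q a => simp [preLift, act]
  | op_smul_left c p a => simp [preLift, act]
  | op_add p a i b c => simp only [preLift, preLift_update, MultilinearMap.map_update_add]
  | op_smul p a i c b => simp only [preLift, preLift_update, MultilinearMap.map_update_smul]
  | op_map σ p a => exact OperadAlgebra.act_map σ p _
  | op_comp p q a => exact OperadAlgebra.act_comp p q _
  | op_one a => exact OperadAlgebra.act_one _

/-- The homomorphism out of the free algebra with prescribed values on the generators. -/
def lift (f : X → B) : FreeAlg P X →ₗ[k] B where
  toFun := Quotient.lift (s := relSetoid P X) (preLift f) (fun _ _ h => preLift_rel f h)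
  map_add' u v := by
    obtain ⟨a, rfl⟩ := mk_surj u
    obtain ⟨b, rfl⟩ := mk_surj v
    rw [← mk_add]; rfl
  map_smul' c u := by
    obtain ⟨a, rfl⟩ := mk_surj u
    rw [← mk_smul]; rfl

theorem lift_gen (f : X → B) (x : X) : lift (P := P) f (gen P x) = f x := rfl

theorem lift_isHom (f : X → B) : IsHom P (lift (P := P) f) := by
  intro r p v
  obtain ⟨a, rfl⟩ : ∃ a : Fin r → Pre P X, v = fun i => mk (a i) :=
    ⟨fun i => rep (v i), funext fun i => (mk_rep _).symm⟩
  rw [act_mk]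
  rfl

theorem hom_unique {f g : FreeAlg P X →ₗ[k] B} (hf : IsHom P f) (hg : IsHom P g)
    (h : ∀ x, f (gen P x) = g (gen P x)) : f = g := by
  ext v
  induction v using induct with
  | hgen x => exact h x
  | hzero => simp
  | hadd v w hv hw => simp [hv, hw]
  | hsmul c v hv => simp [hv]
  | hop r p v hv => rw [hf, hg]; simp only [hv]

theorem derivation_unique {f D D' : FreeAlg P X →ₗ[k] B} (hD : IsDerivationAlong P f D)
    (hD' : IsDerivationAlong P f D') (h : ∀ x, D (gen P x) = D' (gen P x)) : D = D' := by
  ext v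
  induction v using induct with
  | hgen x => exact h x
  | hzero => simp
  | hadd v w hv hw => simp [hv, hw]
  | hsmul c v hv => simp [hv]
  | hop r p v hv => rw [hD, hD']; simp only [hv]

end Lift

end FreeAlg

/-! ### Lie algebras of derivations -/

-- endomorphism rings carry the commutator bracket
attribute [local instance] LieRing.ofAssociativeRing

section Derivations

variable (P : LinearOperad k) (A : Type*) [AddCommGroup A] [Module k A] [OperadAlgebra P A]

/-- The Lie algebra of all derivations of the `P`-algebra `A`, under the commutator bracket. -/
def derAlg : LieSubalgebra k (Module.End k A) where
  carrier := {δ | IsDerivation P δ}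
  zero_mem' := by
    intro r p a
    simp
  add_mem' := by
    intro δ ε hδ hε r p a
    simp [hδ r p a, hε r p a, Finset.sum_add_distrib]
  smul_mem' := by
    intro c δ hδ r p a
    simp [hδ r p a, Finset.smul_sum]
  lie_mem' := by
    intro δ ε hδ hε r p a
    have key : ∀ α β : Module.End k A, IsDerivation P α → IsDerivation P β →
        α (β (act P p a)) = (∑ i, act P p (Function.update a i (α (β (a i))))) +
          ∑ i, ∑ j ∈ Finset.univ.erase i, act P p
            (Function.update (Function.update a i (β (a i))) j (α (a j))) := by
      intro α β hα hβ
      rw [hβ, map_sum, ← Finset.sum_add_distrib]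
      refine Finset.sum_congr rfl fun i _ => ?_
      rw [hα, ← Finset.add_sum_erase _ _ (Finset.mem_univ i)]
      congr 1
      · simp
      · refine Finset.sum_congr rfl fun j hj => ?_
        rw [Function.update_of_ne (Finset.ne_of_mem_erase hj)]
    have swap : (∑ i, ∑ j ∈ Finset.univ.erase i, act P p
            (Function.update (Function.update a i (ε (a i))) j (δ (a j)))) =
        ∑ i, ∑ j ∈ Finset.univ.erase i, act P p
            (Function.update (Function.update a i (δ (a i))) j (ε (a j))) := by
      rw [Finset.sum_comm' (t' := Finset.univ) (s' := fun j => Finset.univ.erase j)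
        (by intro x y; simp [eq_comm])]
      refine Finset.sum_congr rfl fun i _ => Finset.sum_congr rfl fun j hj => ?_
      rw [Function.update_comm (Finset.ne_of_mem_erase hj)]
    have h1 := key δ ε hδ hε
    have h2 := key ε δ hε hδ
    simp only [LieRing.of_associative_ring_bracket, LinearMap.sub_apply, Module.End.mul_apply]
    rw [h1, h2, swap, add_sub_add_right_eq_sub, ← Finset.sum_sub_distrib]
    refine Finset.sum_congr rfl fun i _ => ?_
    rw [MultilinearMap.map_update_sub]

end Derivations

/-! ### Extending derivations from generators

A derivation along a homomorphism `A → B` is a homomorphism to the square-zero extension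
`B ⊕ ε B`, which is used here to extend maps from the generators of a free algebra. -/

section SquareZero

variable (P : LinearOperad k) (B : Type*) [AddCommGroup B] [Module k B]

/-- The underlying space of the square-zero extension `B ⊕ ε B`. -/
def SqZero (_ : LinearOperad k) (B : Type*) : Type _ := B × B

instance : AddCommGroup (SqZero P B) := inferInstanceAs (AddCommGroup (B × B))
instance : Module k (SqZero P B) := inferInstanceAs (Module k (B × B))

/-- The element `a + ε b` of the square-zero extension. -/
def sqMk (a b : B) : SqZero P B := (a, b)

/-- The body of an element of the square-zero extension. -/
def sqFst : SqZero P B →ₗ[k] B := LinearMap.fst k B B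

/-- The `ε`-part of an element of the square-zero extension. -/
def sqSnd : SqZero P B →ₗ[k] B := LinearMap.snd k B B

variable {P B} in
theorem sq_ext {u v : SqZero P B} (h1 : sqFst P B u = sqFst P B v)
    (h2 : sqSnd P B u = sqSnd P B v) : u = v := Prod.ext h1 h2

variable {P B} in
theorem pick_eq {r : ℕ} (v : Fin r → SqZero P B) (i : Fin r) :
    (fun j => (if j = i then sqSnd P B else sqFst P B) (v j)) =
      Function.update (fun j => sqFst P B (v j)) i (sqSnd P B (v i)) := by
  funext j
  by_cases h : j = i
  · subst h; simp
  · simp [h]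

variable [OperadAlgebra P B]

/-- The operation of `p` on the square-zero extension. -/
def sqAct {r : ℕ} (p : P.obj (Fin r)) : MultilinearMap k (fun _ : Fin r => SqZero P B)
    (SqZero P B) :=
  MultilinearMap.prod ((act P p).compLinearMap fun _ => sqFst P B)
    (∑ i, (act P p).compLinearMap fun j => if j = i then sqSnd P B else sqFst P B)

variable {P B}

theorem sqFst_sqAct {r : ℕ} (p : P.obj (Fin r)) (v : Fin r → SqZero P B) :
    sqFst P B (sqAct P B p v) = act P p (fun i => sqFst P B (v i)) := rfl

theorem sqSnd_sqAct {r : ℕ} (p : P.obj (Fin r)) (v : Fin r → SqZero P B) :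
    sqSnd P B (sqAct P B p v) =
      ∑ i, act P p (Function.update (fun j => sqFst P B (v j)) i (sqSnd P B (v i))) := by
  have : sqSnd P B (sqAct P B p v) =
      (∑ i, (act P p).compLinearMap fun j => if j = i then sqSnd P B else sqFst P B) v := rfl
  rw [this, _root_.sum_apply]
  refine Finset.sum_congr rfl fun i _ => ?_
  rw [MultilinearMap.compLinearMap_apply, pick_eq]

instance : OperadAlgebra P (SqZero P B) where
  act {r} :=
    { toFun := fun p => sqAct P B p
      map_add' := fun p q => by
        ext v
        apply sq_ext
        · simp [sqFst_sqAct, act]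
        · simp [sqSnd_sqAct, act, Finset.sum_add_distrib]
      map_smul' := fun c p => by
        ext v
        apply sq_ext
        · simp [sqFst_sqAct, act]
        · simp [sqSnd_sqAct, act, Finset.smul_sum] }
  act_map {r} σ p v := by
    apply sq_ext
    · exact OperadAlgebra.act_map σ p _
    · change sqSnd P B (sqAct P B _ v) = sqSnd P B (sqAct P B _ _)
      rw [sqSnd_sqAct, sqSnd_sqAct, ← σ.sum_comp]
      refine Finset.sum_congr rfl fun i _ => ?_
      refine (OperadAlgebra.act_map σ p _).trans ?_
      unfold act
      congr 1
      funext j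
      by_cases h : j = i
      · subst h; simp
      · simp [h]
  act_comp {r s} p q v := by
    apply sq_ext
    · exact OperadAlgebra.act_comp p q _
    · change sqSnd P B (sqAct P B _ v) = sqSnd P B (sqAct P B p fun i => sqAct P B (q i) _)
      rw [sqSnd_sqAct, sqSnd_sqAct, ← finSigmaFinEquiv.sum_comp, Fintype.sum_sigma]
      refine Finset.sum_congr rfl fun i _ => ?_
      rw [sqSnd_sqAct, MultilinearMap.map_update_sum]
      refine Finset.sum_congr rfl fun j _ => ?_
      refine (OperadAlgebra.act_comp p q _).trans ?_
      unfold act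
      congr 1
      funext i'
      by_cases h : i' = i
      · subst h
        simp only [Function.update_self]
        congr 1
        funext j'
        by_cases h' : j' = j
        · subst h'; simp
        · rw [Function.update_of_ne h', Function.update_of_ne]
          simpa using h'
      · rw [Function.update_of_ne h, sqFst_sqAct]
        unfold act
        congr 1
        funext j'
        rw [Function.update_of_ne]
        intro hc
        exact h (congrArg Sigma.fst (finSigmaFinEquiv.injective hc))
  act_one v := by
    apply sq_ext
    · exact OperadAlgebra.act_one _
    · change sqSnd P B (sqAct P B _ v) = _
      rw [sqSnd_sqAct, Fin.sum_univ_one]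
      refine (OperadAlgebra.act_one _).trans ?_
      simp

end SquareZero

namespace FreeAlg

variable {P : LinearOperad k} {X : Type}

theorem sqFst_lift (f : X → FreeAlg P X) :
    sqFst P _ ∘ₗ lift (P := P) (B := SqZero P (FreeAlg P X)) (fun x => sqMk P _ (gen P x) (f x)) =
      LinearMap.id := by
  refine hom_unique ?_ (fun r p a => rfl) (fun x => rfl)
  intro r p a
  simp only [LinearMap.comp_apply]
  rw [lift_isHom]
  rfl

/-- The derivation of the free algebra with prescribed values on the generators. -/
def extendDer (f : X → FreeAlg P X) : FreeAlg P X →ₗ[k] FreeAlg P X :=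
  sqSnd P _ ∘ₗ lift (P := P) (B := SqZero P (FreeAlg P X)) (fun x => sqMk P _ (gen P x) (f x))

theorem extendDer_gen (f : X → FreeAlg P X) (x : X) : extendDer f (gen P x) = f x := rfl

theorem extendDer_isDerivation (f : X → FreeAlg P X) : IsDerivation P (extendDer f) := by
  intro r p a
  simp only [extendDer, LinearMap.comp_apply]
  rw [lift_isHom]
  refine (sqSnd_sqAct p _).trans ?_
  have h : ∀ v, sqFst P _ (lift (P := P) (B := SqZero P (FreeAlg P X))
      (fun x => sqMk P _ (gen P x) (f x)) v) = v := fun v => LinearMap.congr_fun (sqFst_lift f) v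
  simp only [h]

theorem isDerivation_ext {δ ε : FreeAlg P X →ₗ[k] FreeAlg P X} (hδ : IsDerivation P δ)
    (hε : IsDerivation P ε) (h : ∀ x, δ (gen P x) = ε (gen P x)) : δ = ε :=
  derivation_unique (f := LinearMap.id) hδ hε h

end FreeAlg

/-! ### The Lie algebras `𝔥_n` and `𝔥` -/

section H

variable (P : LinearOperad k)

/-- `𝐕_n`, the free `P`-algebra on `x_0, …, x_{n-1}`. -/
abbrev Vfin (n : ℕ) : Type u := FreeAlg P (Fin n)

/-- `𝐕 = ⋃ 𝐕_n`, the free `P`-algebra on `x_0, x_1, …`. -/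
abbrev Vinf : Type u := FreeAlg P ℕ

/-- `𝔥_n`, the Lie algebra of derivations of `𝐕_n`. -/
abbrev hfin (n : ℕ) : LieSubalgebra k (Module.End k (Vfin P n)) := derAlg P (Vfin P n)

/-- `𝔥 = ⋃ 𝔥_n`: the derivations of `𝐕` that kill all but finitely many of the `x_i`.
See `exists_mem_range_inclH` below for the description as a union. -/
def hinf : LieSubalgebra k (Module.End k (Vinf P)) where
  carrier := {δ | δ ∈ derAlg P (Vinf P) ∧ ∃ m : ℕ, ∀ i, m ≤ i → δ (FreeAlg.gen P i) = 0}
  zero_mem' := ⟨zero_mem _, 0, by simp⟩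
  add_mem' := by
    rintro δ ε ⟨hδ, m, hm⟩ ⟨hε, m', hm'⟩
    refine ⟨add_mem hδ hε, max m m', fun i hi => ?_⟩
    simp [hm i (le_trans (le_max_left _ _) hi), hm' i (le_trans (le_max_right _ _) hi)]
  smul_mem' := by
    rintro c δ ⟨hδ, m, hm⟩
    exact ⟨(derAlg P (Vinf P)).smul_mem c hδ, m, fun i hi => by simp [hm i hi]⟩
  lie_mem' := by
    rintro δ ε ⟨hδ, m, hm⟩ ⟨hε, m', hm'⟩
    refine ⟨(derAlg P (Vinf P)).lie_mem hδ hε, max m m', fun i hi => ?_⟩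
    simp [LieRing.of_associative_ring_bracket, hm i (le_trans (le_max_left _ _) hi),
      hm' i (le_trans (le_max_right _ _) hi)]

/-- The inclusion `𝐕_n → 𝐕`, `x_i ↦ x_i`. -/
def inclV (n : ℕ) : Vfin P n →ₗ[k] Vinf P := FreeAlg.lift (fun i => FreeAlg.gen P (i : ℕ))

/-- The extension by zero of the values of `δ` on the generators. -/
def extGen (n : ℕ) (δ : Module.End k (Vfin P n)) (i : ℕ) : Vinf P :=
  if h : i < n then inclV P n (δ (FreeAlg.gen P ⟨i, h⟩)) else 0

/-- `δ ∈ 𝔥_n` extended to a derivation of `𝐕` that kills `x_i` for `i ≥ n`. -/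
def extDer (n : ℕ) (δ : Module.End k (Vfin P n)) : Module.End k (Vinf P) :=
  FreeAlg.extendDer (extGen P n δ)

variable {P}

theorem extDer_gen_lt (n : ℕ) (δ : Module.End k (Vfin P n)) (i : Fin n) :
    extDer P n δ (FreeAlg.gen P (i : ℕ)) = inclV P n (δ (FreeAlg.gen P i)) := by
  rw [extDer, FreeAlg.extendDer_gen]
  simp [extGen]

theorem extDer_gen_ge (n : ℕ) (δ : Module.End k (Vfin P n)) {i : ℕ} (h : n ≤ i) :
    extDer P n δ (FreeAlg.gen P i) = 0 := by
  rw [extDer, FreeAlg.extendDer_gen]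
  simp [extGen, h]

theorem extDer_mem (n : ℕ) (δ : Module.End k (Vfin P n)) : extDer P n δ ∈ hinf P :=
  ⟨FreeAlg.extendDer_isDerivation _, n, fun _ h => extDer_gen_ge n δ h⟩

theorem inclV_gen (n : ℕ) (i : Fin n) : inclV P n (FreeAlg.gen P i) = FreeAlg.gen P (i : ℕ) := rfl

theorem inclV_isHom (n : ℕ) : IsHom P (inclV P n) := FreeAlg.lift_isHom _

/-- A derivation of `𝐕` restricts to a derivation along the inclusion. -/
theorem comp_inclV (n : ℕ) {D : Module.End k (Vinf P)} (hD : IsDerivation P D) :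
    IsDerivationAlong P (inclV P n) (D ∘ₗ inclV P n) := by
  intro r p a
  simp only [LinearMap.comp_apply]
  rw [inclV_isHom, hD]

theorem inclV_comp (n : ℕ) {δ : Module.End k (Vfin P n)} (hδ : IsDerivation P δ) :
    IsDerivationAlong P (inclV P n) (inclV P n ∘ₗ δ) := by
  intro r p a
  simp only [LinearMap.comp_apply]
  rw [hδ, map_sum]
  refine Finset.sum_congr rfl fun i _ => ?_
  rw [inclV_isHom]
  congr 1
  funext j
  by_cases h : j = i
  · subst h; simp
  · simp [h]

theorem extDer_inclV (n : ℕ) {δ : Module.End k (Vfin P n)} (hδ : IsDerivation P δ)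
    (v : Vfin P n) : extDer P n δ (inclV P n v) = inclV P n (δ v) := by
  have := FreeAlg.derivation_unique (comp_inclV n (FreeAlg.extendDer_isDerivation (extGen P n δ)))
    (inclV_comp n hδ) (fun i => extDer_gen_lt n δ i)
  exact LinearMap.congr_fun this v

theorem hinf_ext {D E : Module.End k (Vinf P)} (hD : D ∈ hinf P) (hE : E ∈ hinf P)
    (h : ∀ i, D (FreeAlg.gen P i) = E (FreeAlg.gen P i)) : D = E :=
  FreeAlg.isDerivation_ext hD.1 hE.1 h

theorem extDer_add (n : ℕ) (δ ε : Module.End k (Vfin P n)) :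
    extDer P n (δ + ε) = extDer P n δ + extDer P n ε := by
  refine hinf_ext (extDer_mem _ _) (add_mem (extDer_mem n _) (extDer_mem n _)) fun i => ?_
  rw [LinearMap.add_apply]
  rcases lt_or_ge i n with h | h
  · lift i to Fin n using h
    rw [extDer_gen_lt, extDer_gen_lt, extDer_gen_lt, LinearMap.add_apply, map_add]
  · rw [extDer_gen_ge n _ h, extDer_gen_ge n _ h, extDer_gen_ge n _ h, add_zero]

theorem extDer_smul (n : ℕ) (c : k) (δ : Module.End k (Vfin P n)) :
    extDer P n (c • δ) = c • extDer P n δ := by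
  refine hinf_ext (extDer_mem _ _) ((hinf P).smul_mem c (extDer_mem n _)) fun i => ?_
  rw [LinearMap.smul_apply]
  rcases lt_or_ge i n with h | h
  · lift i to Fin n using h
    rw [extDer_gen_lt, extDer_gen_lt, LinearMap.smul_apply, map_smul]
  · rw [extDer_gen_ge n _ h, extDer_gen_ge n _ h, smul_zero]

theorem extDer_lie (n : ℕ) {δ ε : Module.End k (Vfin P n)} (hδ : IsDerivation P δ)
    (hε : IsDerivation P ε) : extDer P n ⁅δ, ε⁆ = ⁅extDer P n δ, extDer P n ε⁆ := by
  refine hinf_ext (extDer_mem _ _) ((hinf P).lie_mem (extDer_mem n _) (extDer_mem n _))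
    fun i => ?_
  rw [LieRing.of_associative_ring_bracket, LieRing.of_associative_ring_bracket,
    LinearMap.sub_apply, Module.End.mul_apply, Module.End.mul_apply]
  rcases lt_or_ge i n with h | h
  · lift i to Fin n using h
    rw [extDer_gen_lt, extDer_gen_lt, extDer_gen_lt, extDer_inclV n hδ, extDer_inclV n hε,
      LinearMap.sub_apply, Module.End.mul_apply, Module.End.mul_apply, map_sub]
  · rw [extDer_gen_ge n _ h, extDer_gen_ge n _ h, extDer_gen_ge n _ h, map_zero, map_zero,
      sub_zero]

variable (P)

/-- The inclusion of Lie algebras `𝔥_n ⊆ 𝔥`. -/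
def inclH (n : ℕ) : hfin P n →ₗ⁅k⁆ hinf P where
  toFun δ := ⟨extDer P n δ, extDer_mem (P := P) n δ⟩
  map_add' δ ε := Subtype.ext (extDer_add (P := P) n δ ε)
  map_smul' c δ := Subtype.ext (extDer_smul (P := P) n c δ)
  map_lie' := fun {δ ε} => Subtype.ext (extDer_lie (P := P) n δ.2 ε.2)

theorem inclV_inclV {m n : ℕ} (h : m ≤ n) (v : Vfin P m) :
    ∃ w : Vfin P n, inclV P n w = inclV P m v := by
  refine ⟨FreeAlg.lift (fun i => FreeAlg.gen P (Fin.castLE h i)) v, ?_⟩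
  refine LinearMap.congr_fun (f := inclV P n ∘ₗ FreeAlg.lift _) (FreeAlg.hom_unique ?_
    (inclV_isHom m) (fun i => rfl)) v
  intro r p a
  simp only [LinearMap.comp_apply]
  rw [FreeAlg.lift_isHom, inclV_isHom]

theorem exists_inclV (v : Vinf P) : ∃ m, ∀ n, m ≤ n → ∃ w : Vfin P n, inclV P n w = v := by
  induction v using FreeAlg.induct with
  | hgen i => exact ⟨i + 1, fun n hn => ⟨FreeAlg.gen P ⟨i, hn⟩, rfl⟩⟩
  | hzero => exact ⟨0, fun n _ => ⟨0, map_zero _⟩⟩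
  | hadd v w hv hw =>
    obtain ⟨m, hm⟩ := hv
    obtain ⟨m', hm'⟩ := hw
    refine ⟨max m m', fun n hn => ?_⟩
    obtain ⟨a, rfl⟩ := hm n (le_trans (le_max_left _ _) hn)
    obtain ⟨b, rfl⟩ := hm' n (le_trans (le_max_right _ _) hn)
    exact ⟨a + b, map_add _ _ _⟩
  | hsmul c v hv =>
    obtain ⟨m, hm⟩ := hv
    refine ⟨m, fun n hn => ?_⟩
    obtain ⟨a, rfl⟩ := hm n hn
    exact ⟨c • a, map_smul _ _ _⟩
  | hop r p v hv =>
    choose m hm using hv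
    refine ⟨Finset.univ.sup m, fun n hn => ?_⟩
    choose w hw using fun i => hm i n (le_trans (Finset.le_sup (Finset.mem_univ i)) hn)
    exact ⟨act P p w, by rw [inclV_isHom]; simp only [hw]⟩

/-- `𝔥` is the union of the `𝔥_n`. -/
theorem exists_mem_range_inclH (D : hinf P) : ∃ n, D ∈ (inclH P n).range := by
  obtain ⟨D, hD, m, hm⟩ := D
  choose M hM using fun i : ℕ => exists_inclV P (D (FreeAlg.gen P i))
  let n := max m ((Finset.range m).sup M)
  have key : ∀ i, ∃ w : Vfin P n, inclV P n w = D (FreeAlg.gen P i) := by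
    intro i
    rcases lt_or_ge i m with h | h
    · exact hM i n (le_trans (Finset.le_sup (Finset.mem_range.2 h)) (le_max_right _ _))
    · exact ⟨0, by simp [hm i h]⟩
  choose w hw using key
  refine ⟨n, (LieHom.mem_range _ _).2 ⟨⟨FreeAlg.extendDer (fun i => w i),
    FreeAlg.extendDer_isDerivation _⟩, Subtype.ext (hinf_ext (extDer_mem n _) ⟨hD, m, hm⟩
      fun i => ?_)⟩⟩
  rcases lt_or_ge i n with h | h
  · refine (extDer_gen_lt (P := P) n _ ⟨i, h⟩).trans ?_
    rw [FreeAlg.extendDer_gen]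
    exact hw i
  · rw [hm i (le_trans (le_max_left _ _) h)]
    exact extDer_gen_ge n _ h

/-- `𝔤𝔩_{∞-n} ⊆ 𝔥`: the derivations that kill `x_0, …, x_{n-1}` and map each `x_i` with `i ≥ n`
to a linear combination of the `x_j` with `j ≥ n` (and kill almost all `x_i`). -/
def glRest (n : ℕ) : LieSubalgebra k (hinf P) where
  carrier := {γ | (∀ i, i < n → (γ : Module.End k (Vinf P)) (FreeAlg.gen P i) = 0) ∧
    ∀ i, n ≤ i → (γ : Module.End k (Vinf P)) (FreeAlg.gen P i) ∈
      Submodule.span k (FreeAlg.gen P '' Set.Ici n)}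
  zero_mem' := by simp
  add_mem' := by
    rintro γ γ' ⟨h1, h2⟩ ⟨h1', h2'⟩
    exact ⟨fun i hi => by simp [h1 i hi, h1' i hi], fun i hi => add_mem (h2 i hi) (h2' i hi)⟩
  smul_mem' := by
    rintro c γ ⟨h1, h2⟩
    exact ⟨fun i hi => by simp [h1 i hi], fun i hi => Submodule.smul_mem _ c (h2 i hi)⟩
  lie_mem' := by
    have key : ∀ γ : hinf P, (∀ i, n ≤ i → (γ : Module.End k (Vinf P)) (FreeAlg.gen P i) ∈
        Submodule.span k (FreeAlg.gen P '' Set.Ici n)) →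
        ∀ v ∈ Submodule.span k (FreeAlg.gen P '' Set.Ici n), (γ : Module.End k (Vinf P)) v ∈
          Submodule.span k (FreeAlg.gen P '' Set.Ici n) := by
      intro γ h
      suffices Submodule.span k (FreeAlg.gen P '' Set.Ici n) ≤
          (Submodule.span k (FreeAlg.gen P '' Set.Ici n)).comap (γ : Module.End k (Vinf P)) from
        this
      rw [Submodule.span_le]
      rintro _ ⟨i, hi, rfl⟩
      exact h i hi
    rintro γ γ' ⟨h1, h2⟩ ⟨h1', h2'⟩
    refine ⟨fun i hi => ?_, fun i hi => ?_⟩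
    · simp [LieRing.of_associative_ring_bracket, h1 i hi, h1' i hi]
    · exact sub_mem (key γ h2 _ (h2' i hi)) (key γ' h2' _ (h2 i hi))

variable {P}

/-- `𝔥_n` commutes with `𝔤𝔩_{∞-n}`. -/
theorem inclH_commute (n : ℕ) (δ : hfin P n) (γ : hinf P) (hγ : γ ∈ glRest P n) :
    ⁅inclH P n δ, γ⁆ = 0 := by
  have h1 : ∀ v, (γ : Module.End k (Vinf P)) (inclV P n v) = 0 := by
    intro v
    refine LinearMap.congr_fun (FreeAlg.derivation_unique (comp_inclV n γ.2.1)
      (D' := 0) ?_ (fun i => ?_)) v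
    · intro r p a; simp
    · exact hγ.1 i i.2
  have h2 : Submodule.span k (FreeAlg.gen P '' Set.Ici n) ≤ LinearMap.ker (extDer P n δ) := by
    rw [Submodule.span_le]
    rintro _ ⟨i, hi, rfl⟩
    exact extDer_gen_ge n _ hi
  refine Subtype.ext (hinf_ext ((hinf P).lie_mem (extDer_mem n _) γ.2) (zero_mem _) fun i => ?_)
  change extDer P n δ ((γ : Module.End k (Vinf P)) (FreeAlg.gen P i)) -
    (γ : Module.End k (Vinf P)) (extDer P n δ (FreeAlg.gen P i)) = 0
  rcases lt_or_ge i n with h | h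
  · have h3 := extDer_gen_lt (P := P) n δ ⟨i, h⟩
    simp only at h3
    rw [hγ.1 i h, h3, h1, map_zero, sub_zero]
  · rw [extDer_gen_ge n _ h, map_zero, sub_zero]
    exact h2 (hγ.2 i h)

end H

/-! ### Polynomial representations -/

section Poly

open scoped TensorProduct

variable (k) (L : Type u) [LieRing L] [LieAlgebra k L]

section Tensor

variable (V : Type u) [AddCommGroup V] [Module k V] [LieRingModule L V] [LieModule k L V]

/-- The action of `x ∈ L` on the tensor power `V^{⊗ d}`. -/
def tensorEnd (d : ℕ) (x : L) : Module.End k (⨂[k] _ : Fin d, V) :=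
  ∑ i, PiTensorProduct.map (Function.update (fun _ => LinearMap.id) i (LieModule.toEnd k L V x))

variable {L V}

/-- `x (v₁ ⊗ ⋯ ⊗ v_d) = ∑ i, v₁ ⊗ ⋯ ⊗ x v_i ⊗ ⋯ ⊗ v_d`. -/
theorem tensorEnd_tprod (d : ℕ) (x : L) (v : Fin d → V) :
    tensorEnd k L V d x (PiTensorProduct.tprod k v) =
      ∑ i, PiTensorProduct.tprod k (Function.update v i ⁅x, v i⁆) := by
  rw [tensorEnd, LinearMap.sum_apply]
  refine Finset.sum_congr rfl fun i _ => ?_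
  rw [PiTensorProduct.map_tprod]
  congr 1
  funext j
  by_cases h : j = i
  · subst h; simp
  · simp [h]

theorem tensorEnd_lie (d : ℕ) (x y : L) :
    tensorEnd k L V d ⁅x, y⁆ = tensorEnd k L V d x * tensorEnd k L V d y -
      tensorEnd k L V d y * tensorEnd k L V d x := by
  refine PiTensorProduct.ext (MultilinearMap.ext fun v => ?_)
  have key : ∀ a b : L, tensorEnd k L V d a (tensorEnd k L V d b (PiTensorProduct.tprod k v)) =
      (∑ i, PiTensorProduct.tprod k (Function.update v i ⁅a, ⁅b, v i⁆⁆)) +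
        ∑ i, ∑ j ∈ Finset.univ.erase i, PiTensorProduct.tprod k
          (Function.update (Function.update v i ⁅b, v i⁆) j ⁅a, v j⁆) := by
    intro a b
    rw [tensorEnd_tprod, map_sum, ← Finset.sum_add_distrib]
    refine Finset.sum_congr rfl fun i _ => ?_
    rw [tensorEnd_tprod, ← Finset.add_sum_erase _ _ (Finset.mem_univ i)]
    congr 1
    · simp
    · refine Finset.sum_congr rfl fun j hj => ?_
      rw [Function.update_of_ne (Finset.ne_of_mem_erase hj)]
  have swap : (∑ i, ∑ j ∈ Finset.univ.erase i, PiTensorProduct.tprod k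
        (Function.update (Function.update v i ⁅y, v i⁆) j ⁅x, v j⁆)) =
      ∑ i, ∑ j ∈ Finset.univ.erase i, PiTensorProduct.tprod k
        (Function.update (Function.update v i ⁅x, v i⁆) j ⁅y, v j⁆) := by
    rw [Finset.sum_comm' (t' := Finset.univ) (s' := fun j => Finset.univ.erase j)
      (by intro a b; simp [eq_comm])]
    refine Finset.sum_congr rfl fun i _ => Finset.sum_congr rfl fun j hj => ?_
    rw [Function.update_comm (Finset.ne_of_mem_erase hj)]
  simp only [LinearMap.compMultilinearMap_apply, LinearMap.sub_apply, Module.End.mul_apply]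
  rw [key x y, key y x, swap, add_sub_add_right_eq_sub, ← Finset.sum_sub_distrib, tensorEnd_tprod]
  refine Finset.sum_congr rfl fun i _ => ?_
  rw [lie_lie, MultilinearMap.map_update_sub]

instance (d : ℕ) : LieRingModule L (⨂[k] _ : Fin d, V) where
  bracket x t := tensorEnd k L V d x t
  add_lie x y t := by
    rw [← LinearMap.add_apply]
    congr 1
    refine PiTensorProduct.ext (MultilinearMap.ext fun v => ?_)
    simp [tensorEnd_tprod, Finset.sum_add_distrib]
  lie_add x s t := map_add _ s t
  leibniz_lie x y t := by
    change tensorEnd k L V d x (tensorEnd k L V d y t) = tensorEnd k L V d ⁅x, y⁆ t +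
      tensorEnd k L V d y (tensorEnd k L V d x t)
    rw [tensorEnd_lie]
    simp

instance (d : ℕ) : LieModule k L (⨂[k] _ : Fin d, V) where
  smul_lie c x t := by
    change tensorEnd k L V d (c • x) t = c • tensorEnd k L V d x t
    rw [← LinearMap.smul_apply]
    congr 1
    refine PiTensorProduct.ext (MultilinearMap.ext fun v => ?_)
    simp [tensorEnd_tprod, Finset.smul_sum]
  lie_smul c x t := map_smul _ c t

end Tensor

/-- A representation of the Lie algebra `L` over `k`. -/
structure LieRep where
  carrier : Type u
  [addCommGroup : AddCommGroup carrier]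
  [module : Module k carrier]
  [lieRingModule : LieRingModule L carrier]
  [lieModule : LieModule k L carrier]

attribute [instance] LieRep.addCommGroup LieRep.module LieRep.lieRingModule LieRep.lieModule

instance : Category (LieRep k L) where
  Hom M N := M.carrier →ₗ⁅k, L⁆ N.carrier
  id M := LieModuleHom.id
  comp f g := g.comp f

/-- A representation of `L` is polynomial (with respect to the standard representation `V`) if it
is a subquotient `A / B` of a (possibly infinite) direct sum of tensor powers of `V`. -/
def IsPolynomial (V : Type u) [AddCommGroup V] [Module k V] [LieRingModule L V]
    [LieModule k L V] : ObjectProperty (LieRep k L) := fun M =>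
  ∃ (ι : Type u) (d : ι → ℕ) (A : LieSubmodule k L (DirectSum ι fun i => ⨂[k] _ : Fin (d i), V))
    (B : LieSubmodule k L A), Nonempty ((A ⧸ B) ≃ₗ⁅k, L⁆ M.carrier)

end Poly

section Specialization

variable (P : LinearOperad k) (n : ℕ)

/-- The property of being a polynomial representation of `𝔥`. -/
abbrev polInf : ObjectProperty (LieRep k (hinf P)) := IsPolynomial k (hinf P) (Vinf P)

/-- The property of being a polynomial representation of `𝔥_n`. -/
abbrev polFin : ObjectProperty (LieRep k (hfin P n)) := IsPolynomial k (hfin P n) (Vfin P n)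

/-- The category `Rep^pol(𝔥)`. -/
abbrev RepPolInf := (polInf P).FullSubcategory

/-- The category `Rep^pol(𝔥_n)`. -/
abbrev RepPolFin := (polFin P n).FullSubcategory

/-- The space of `𝔤𝔩_{∞-n}`-invariants of an `𝔥`-module. -/
def Invariants (M : LieRep k (hinf P)) : Submodule k M.carrier :=
  (LieModule.maxTrivSubmodule k (glRest P n) M.carrier).toSubmodule

variable {P n}

theorem mem_invariants {M : LieRep k (hinf P)} {m : M.carrier} :
    m ∈ Invariants P n M ↔ ∀ γ ∈ glRest P n, ⁅γ, m⁆ = 0 :=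
  ⟨fun h γ hγ => h ⟨γ, hγ⟩, fun h γ => h γ.1 γ.2⟩

theorem lie_mem_invariants {M : LieRep k (hinf P)} (δ : hfin P n) {m : M.carrier}
    (hm : m ∈ Invariants P n M) : ⁅inclH P n δ, m⁆ ∈ Invariants P n M := by
  rw [mem_invariants] at hm ⊢
  intro γ hγ
  rw [leibniz_lie, hm γ hγ, lie_zero, add_zero, ← lie_skew, inclH_commute n δ γ hγ, neg_zero,
    zero_lie]

/-- The action of `𝔥_n ⊆ 𝔥` on the `𝔤𝔩_{∞-n}`-invariants. -/
instance (M : LieRep k (hinf P)) : LieRingModule (hfin P n) (Invariants P n M) where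
  bracket δ m := ⟨⁅inclH P n δ, (m : M.carrier)⁆, lie_mem_invariants δ m.2⟩
  add_lie δ ε m := Subtype.ext (by simp)
  lie_add δ m m' := Subtype.ext (by simp)
  leibniz_lie δ ε m := Subtype.ext (by simp)

instance (M : LieRep k (hinf P)) : LieModule k (hfin P n) (Invariants P n M) where
  smul_lie c δ m := Subtype.ext (by
    change ⁅inclH P n (c • δ), (m : M.carrier)⁆ = c • ⁅inclH P n δ, (m : M.carrier)⁆
    rw [map_smul, smul_lie])
  lie_smul c δ m := Subtype.ext (by
    change ⁅inclH P n δ, c • (m : M.carrier)⁆ = c • ⁅inclH P n δ, (m : M.carrier)⁆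
    rw [lie_smul])

variable (P n)

/-- The functor `M ↦ M^{𝔤𝔩_{∞-n}}` from polynomial `𝔥`-modules to `𝔥_n`-modules. -/
def invariantsFunctor : RepPolInf P ⥤ LieRep k (hfin P n) where
  obj M := { carrier := Invariants P n M.obj }
  map {M N} f :=
    let g : M.obj.carrier →ₗ⁅k, hinf P⁆ N.obj.carrier := f.hom
    { toLinearMap := (g : M.obj.carrier →ₗ[k] N.obj.carrier).restrict (fun m hm => by
        rw [mem_invariants] at hm ⊢
        intro γ hγ
        change ⁅γ, g m⁆ = 0
        rw [← LieModuleHom.map_lie, hm γ hγ, map_zero])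
      map_lie' := fun {δ m} => Subtype.ext (LieModuleHom.map_lie g (inclH P n δ) m) }
  map_id _ := rfl
  map_comp _ _ := rfl

/-- The specialization functor `Γ_n : Rep^pol(𝔥) ⥤ Rep^pol(𝔥_n)`, given that invariants of
polynomial representations are polynomial. -/
def specialization (h : ∀ M : RepPolInf P, polFin P n ((invariantsFunctor P n).obj M)) :
    RepPolInf P ⥤ RepPolFin P n :=
  (polFin P n).lift (invariantsFunctor P n) h

end Specialization

end OperadRep
end

/-! Write T = ⨁ 𝐕^{⊗ d i} and regard T_n = ⨁ 𝐕_n^{⊗ d i} as a subspace of T. The proof rests on one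
computation: if `A` is an 𝔥-submodule of T and `q : A → M` is a surjection of 𝔥-modules, then Γ_n(M)
= q(A ∩ T_n).

Derivations in 𝔤𝔩_{∞-n} kill T_n, which gives one inclusion. For the other, let E be the derivation
fixing x_i for i ≥ n and killing the remaining generators. By the Leibniz rule E grades T by the
degree in the x_i with i ≥ n, and the part of degree 0 is T_n. Although E moves infinitely many
generators, on any given element of T it agrees with a truncation lying in 𝔤𝔩_{∞-n}. Hence, if q(a)
is invariant, then E a ∈ ker q, and in characteristic 0 the components of a of positive degree can
be removed modulo ker q (`exists_incl_of_mem_invariants`). So Γ_n(M) is a quotient of A ∩ T_n, in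
particular polynomial.

For essential surjectivity, take 𝔥_n-submodules B ⊆ A of T_n. Let A' be the smallest subspace of T
that contains A and is stable under the "head" derivations, those that kill x_i for i ≥ n. Two facts
carry the argument: - A' is an 𝔥-submodule (`tail_lie_mem_sInf_headStable`). Every derivation is the
sum of a head and a "tail", which kills x_i for i < n; tails kill A, and commutators propagate this
to A'. - A' ∩ T_n = A (`mem_iff_incl_mem_extendInf`). The retraction 𝐕 → 𝐕_n intertwines head
derivations with elements of 𝔥_n, so the preimage of A under the induced map T → T_n contains A'.
With B' built from B in the same way, the computation above applied to A' / (A' ∩ B') returns A / B.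
-/

noncomputable section

namespace OperadRep

attribute [local instance] LieRing.ofAssociativeRing

open scoped TensorProduct

/-! ### Linear algebra: spans and eigenvectors with natural number eigenvalues. -/

section LinearAlgebra

variable {k : Type*} [Field k]

/-- A multilinear map sends spans into a submodule that contains its values on spanning vectors. -/
theorem _root_.MultilinearMap.apply_mem_of_forall_mem_span {ι : Type*} [Fintype ι]
    {V W : Type*} [AddCommGroup V] [Module k V] [AddCommGroup W] [Module k W]
    (f : MultilinearMap k (fun _ : ι => V) W) {S : Set V} {Q : Submodule k W}
    (hf : ∀ v : ι → V, (∀ i, v i ∈ S) → f v ∈ Q) (v : ι → V)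
    (hv : ∀ i, v i ∈ Submodule.span k S) : f v ∈ Q := by
  classical
  -- `F` is the set of coordinates already relaxed from `S` to its span; they are relaxed one at a
  -- time, by linearity in that coordinate.
  suffices key : ∀ (F : Finset ι) (v : ι → V), (∀ i ∈ F, v i ∈ Submodule.span k S) →
      (∀ i ∉ F, v i ∈ S) → f v ∈ Q from
    key Finset.univ v (fun i _ => hv i) (by simp)
  intro F
  induction F using Finset.induction_on with
  | empty => exact fun v _ h => hf v (by simpa using h)
  | insert a F ha ih =>
    intro v h1 h2
    have h : Submodule.span k S ≤ Q.comap (f.toLinearMap v a) := by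
      rw [Submodule.span_le]
      intro s hs
      refine ih _ (fun i hi => ?_) (fun i hi => ?_)
      · rw [Function.update_of_ne (by rintro rfl; exact ha hi)]
        exact h1 i (Finset.mem_insert_of_mem hi)
      · by_cases hia : i = a
        · subst hia; simpa using hs
        · rw [Function.update_of_ne hia]
          exact h2 i (by simp [hia, hi])
    simpa using h (h1 a (Finset.mem_insert_self _ _))

variable {T : Type*} [AddCommGroup T] [Module k T]

/-- The sum of `R` and of the eigenspaces of `E` for the eigenvalues `1, …, J`. -/
def addEigenspaces (E : Module.End k T) (R : Submodule k T) : ℕ → Submodule k T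
  | 0 => R
  | J + 1 => addEigenspaces E R J ⊔ E.eigenspace ((J + 1 : ℕ) : k)

theorem addEigenspaces_mono (E : Module.End k T) (R : Submodule k T) :
    Monotone (addEigenspaces E R) :=
  monotone_nat_of_le_succ fun _ => le_sup_left

theorem mapsTo_addEigenspaces {E : Module.End k T} {R : Submodule k T} (hR : ∀ r ∈ R, E r = 0)
    (J : ℕ) : ∀ t ∈ addEigenspaces E R J, E t ∈ addEigenspaces E R J := by
  induction J with
  | zero => intro t ht; rw [hR t ht]; exact zero_mem _
  | succ J ih =>
    intro t ht
    obtain ⟨r, hr, s, hs, rfl⟩ := Submodule.mem_sup.1 ht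
    rw [map_add]
    refine Submodule.add_mem_sup (ih r hr) ?_
    rw [Module.End.mem_eigenspace_iff.1 hs]
    exact Submodule.smul_mem _ _ hs

/-- An element of `A` that `E` maps into `B` is congruent modulo `B` to an element of the zero
eigenspace. -/
theorem exists_sub_mem_of_mem_addEigenspaces [CharZero k] {E : Module.End k T}
    {R : Submodule k T} (hR : ∀ r ∈ R, E r = 0) {A B : Submodule k T} (hBA : B ≤ A)
    (hB : ∀ b ∈ B, E b ∈ B) (J : ℕ) :
    ∀ a ∈ A, a ∈ addEigenspaces E R J → E a ∈ B → ∃ r ∈ R, r ∈ A ∧ a - r ∈ B := by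
  induction J with
  | zero => exact fun a ha har _ => ⟨a, har, ha, by simp⟩
  | succ J ih =>
    intro a ha haR haB
    -- Subtracting (J + 1)⁻¹ E a removes the component of eigenvalue J + 1 and, since E a ∈ `B`,
    -- does not change the class modulo `B`. The division is where characteristic 0 enters.
    have hJ : ((J + 1 : ℕ) : k) ≠ 0 := by exact_mod_cast Nat.succ_ne_zero J
    have hsub : ((J + 1 : ℕ) : k)⁻¹ • E a ∈ B := B.smul_mem _ haB
    have h1 : a - ((J + 1 : ℕ) : k)⁻¹ • E a ∈ addEigenspaces E R J := by
      obtain ⟨x, hx, s, hs, rfl⟩ := Submodule.mem_sup.1 haR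
      rw [map_add, Module.End.mem_eigenspace_iff.1 hs, smul_add, smul_smul, inv_mul_cancel₀ hJ,
        one_smul, add_sub_add_right_eq_sub]
      exact sub_mem hx (Submodule.smul_mem _ _ (mapsTo_addEigenspaces hR J x hx))
    have h2 : E (a - ((J + 1 : ℕ) : k)⁻¹ • E a) ∈ B := by
      rw [map_sub, map_smul]
      exact sub_mem haB (B.smul_mem _ (hB _ haB))
    obtain ⟨r, hr, hrA, h⟩ := ih _ (sub_mem ha (hBA hsub)) h1 h2
    refine ⟨r, hr, hrA, ?_⟩
    have := add_mem h hsub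
    rwa [sub_right_comm, sub_add_cancel] at this

/-- The eigenvectors of `E` for natural number eigenvalues that lie in `R` if they are killed
by `E`. -/
def natEigenvectors (E : Module.End k T) (R : Submodule k T) : Set T :=
  {t | ∃ j : ℕ, E t = (j : k) • t ∧ (j = 0 → t ∈ R)}

/-- A vector involves only finitely many eigenvalues, so the induction on the largest one in
`exists_sub_mem_of_mem_addEigenspaces` applies to it. -/
theorem exists_mem_addEigenspaces {E : Module.End k T} {R : Submodule k T} {t : T}
    (ht : t ∈ Submodule.span k (natEigenvectors E R)) : ∃ J, t ∈ addEigenspaces E R J := by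
  induction ht using Submodule.span_induction with
  | mem t ht =>
    obtain ⟨j, hj, h0⟩ := ht
    refine ⟨j, ?_⟩
    cases j with
    | zero => exact h0 rfl
    | succ j => exact Submodule.mem_sup_right (Module.End.mem_eigenspace_iff.2 hj)
  | zero => exact ⟨0, zero_mem _⟩
  | add x y _ _ hx hy =>
    obtain ⟨J, hJ⟩ := hx
    obtain ⟨K, hK⟩ := hy
    exact ⟨max J K, add_mem (addEigenspaces_mono E R (le_max_left _ _) hJ)
      (addEigenspaces_mono E R (le_max_right _ _) hK)⟩
  | smul c x _ hx =>
    obtain ⟨J, hJ⟩ := hx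
    exact ⟨J, Submodule.smul_mem _ _ hJ⟩

end LinearAlgebra

/-! ### The first isomorphism theorem for Lie modules. -/

section LieModules

variable {k : Type*} [CommRing k] {L : Type*} [LieRing L] [LieAlgebra k L]

/-- The first isomorphism theorem for Lie modules. -/
def quotEquivOfSurjective {M N : Type*} [AddCommGroup M] [Module k M] [LieRingModule L M]
    [LieModule k L M] [AddCommGroup N] [Module k N] [LieRingModule L N] [LieModule k L N]
    (f : M →ₗ⁅k, L⁆ N) (hf : Function.Surjective f) (B : LieSubmodule k L M)
    (hB : ∀ m, m ∈ B ↔ f m = 0) : (M ⧸ B) ≃ₗ⁅k, L⁆ N :=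
  let g : (M ⧸ B.toSubmodule) ≃ₗ[k] N :=
    (Submodule.quotEquivOfEq _ _ (by ext m; simp [hB])).trans
      ((f : M →ₗ[k] N).quotKerEquivOfSurjective hf)
  { g with
    map_lie' := by
      rintro x ⟨m⟩
      exact LieModuleHom.map_lie f x m }

end LieModules

/-! ### Direct sums of tensor powers and their functoriality. -/

section TensorSum

variable {k : Type u} [Field k] {L L' : Type u} [LieRing L] [LieAlgebra k L] [LieRing L']
  [LieAlgebra k L'] {V V' V'' : Type u} [AddCommGroup V] [Module k V] [LieRingModule L V]
  [LieModule k L V]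
  [AddCommGroup V'] [Module k V'] [LieRingModule L' V'] [LieModule k L' V'] [AddCommGroup V'']
  [Module k V'']

/-- A direct sum of tensor powers of `V`. -/
abbrev TensorSum (k : Type u) [Field k] (V : Type u) [AddCommGroup V] [Module k V] {ι : Type u}
    (d : ι → ℕ) : Type u := DirectSum ι fun i => ⨂[k] _ : Fin (d i), V

variable {ι : Type u} (d : ι → ℕ)

section Subalgebra

variable {E : Type u} [LieRing E] [LieAlgebra k E] [LieRingModule E V] [LieModule k E V]

/-- The action of a Lie subalgebra on sums of tensor powers, preferred to the restriction of the
action of the ambient Lie algebra. -/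
instance (H : LieSubalgebra k E) : LieRingModule H (TensorSum k V d) :=
  DirectSum.instLieRingModule (L := H)

instance (H : LieSubalgebra k E) : LieModule k H (TensorSum k V d) :=
  DirectSum.instLieModule (L := H)

instance (H : LieSubalgebra k E) : Bracket H (TensorSum k V d) :=
  LieRingModule.toBracket

end Subalgebra

/-- The linear map between direct sums of tensor powers induced by `f : V → V'`. -/
def tensorSumMap (f : V →ₗ[k] V') : TensorSum k V d →ₗ[k] TensorSum k V' d :=
  DirectSum.lmap fun _ => PiTensorProduct.map fun _ => f

/-- Pure tensors in a direct sum of tensor powers. -/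
def pureTensor [DecidableEq ι] (i : ι) : MultilinearMap k (fun _ : Fin (d i) => V)
    (TensorSum k V d) :=
  (DirectSum.lof k ι (fun i => ⨂[k] _ : Fin (d i), V) i).compMultilinearMap
    (PiTensorProduct.tprod k)

theorem tensorSumMap_pureTensor [DecidableEq ι] (f : V →ₗ[k] V') (i : ι) (v : Fin (d i) → V) :
    tensorSumMap d f (pureTensor d i v) = pureTensor d i fun j => f (v j) := by
  simp [tensorSumMap, pureTensor]

theorem lie_pureTensor [DecidableEq ι] (x : L) (i : ι) (v : Fin (d i) → V) :
    ⁅x, pureTensor (k := k) d i v⁆ =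
      ∑ j, pureTensor (k := k) d i (Function.update v j ⁅x, v j⁆) := by
  simp only [pureTensor, LinearMap.compMultilinearMap_apply]
  rw [← map_sum, ← tensorEnd_tprod]
  exact (LieModuleHom.map_lie (DirectSum.lieModuleOf k ι L
    (fun i => ⨂[k] _ : Fin (d i), V) i) x _).symm

variable {d} in
theorem tensorSum_induction {C : TensorSum k V d → Prop} (h0 : C 0)
    (hadd : ∀ s t, C s → C t → C (s + t)) (hsmul : ∀ (c : k) t, C t → C (c • t))
    (hpure : ∀ [DecidableEq ι] (i : ι) (v : Fin (d i) → V), C (pureTensor d i v))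
    (t : TensorSum k V d) : C t := by
  classical
  induction t using DirectSum.induction_on with
  | zero => exact h0
  | of i t =>
    induction t using PiTensorProduct.induction_on with
    | smul_tprod c v =>
      have := hsmul c _ (hpure i v)
      rw [pureTensor, LinearMap.compMultilinearMap_apply, ← map_smul] at this
      exact this
    | add s t hs ht => rw [map_add]; exact hadd _ _ hs ht
  | add s t hs ht => exact hadd _ _ hs ht

theorem tensorSumMap_id (t : TensorSum k V d) : tensorSumMap d (LinearMap.id : V →ₗ[k] V) t = t := by
  induction t using tensorSum_induction with
  | h0 => simp
  | hadd s t hs ht => rw [map_add, hs, ht]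
  | hsmul c t ht => rw [map_smul, ht]
  | hpure i v => rw [tensorSumMap_pureTensor]; rfl

theorem tensorSumMap_comp (g : V' →ₗ[k] V'') (f : V →ₗ[k] V') (t : TensorSum k V d) :
    tensorSumMap d g (tensorSumMap d f t) = tensorSumMap d (g ∘ₗ f) t := by
  induction t using tensorSum_induction with
  | h0 => simp
  | hadd s t hs ht => simp only [map_add, hs, ht]
  | hsmul c t ht => simp only [map_smul, ht]
  | hpure i v => simp only [tensorSumMap_pureTensor]; rfl

/-- If `f` intertwines `x` and `y`, then so does the induced map of sums of tensor powers. -/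
theorem tensorSumMap_lie {f : V →ₗ[k] V'} {x : L} {y : L'} (h : ∀ v, f ⁅x, v⁆ = ⁅y, f v⁆)
    (t : TensorSum k V d) : tensorSumMap d f ⁅x, t⁆ = ⁅y, tensorSumMap d f t⁆ := by
  induction t using tensorSum_induction with
  | h0 => simp
  | hadd s t hs ht => simp only [lie_add, map_add, hs, ht]
  | hsmul c t ht => rw [lie_smul c x t, map_smul, map_smul, lie_smul c y (tensorSumMap d f t), ht]
  | hpure i v =>
    rw [lie_pureTensor, map_sum, tensorSumMap_pureTensor, lie_pureTensor]
    refine Finset.sum_congr rfl fun j _ => ?_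
    rw [tensorSumMap_pureTensor]
    congr 1
    funext l
    by_cases hl : l = j
    · subst hl; simp [h]
    · simp [hl]

/-- If the natural eigenvectors of `x` span `V`, then they span sums of tensor powers. -/
theorem span_natEigenvectors_tensorSum (x : L) (f : V' →ₗ[k] V)
    (h : Submodule.span k (natEigenvectors (LieModule.toEnd k L V x) (LinearMap.range f)) = ⊤) :
    Submodule.span k (natEigenvectors (LieModule.toEnd k L (TensorSum k V d) x)
      (LinearMap.range (tensorSumMap d f))) = ⊤ := by
  rw [eq_top_iff]
  rintro t -
  induction t using tensorSum_induction with
  | h0 => exact zero_mem _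
  | hadd s t hs ht => exact add_mem hs ht
  | hsmul c t ht => exact Submodule.smul_mem _ _ ht
  | hpure i v =>
    refine MultilinearMap.apply_mem_of_forall_mem_span _ (fun v hv => Submodule.subset_span ?_) v
      (fun j => by rw [h]; exact Submodule.mem_top)
    choose w hw hw0 using hv
    -- Eigenvalues add up over the factors of a pure tensor. A sum of natural numbers vanishes only
    -- if every term does, so at eigenvalue 0 all factors come from `V'`; this is why the
    -- eigenvalues are recorded in ℕ and not in `k`.
    refine ⟨∑ j, w j, ?_, fun h0 => ?_⟩
    · rw [LieModule.toEnd_apply_apply, lie_pureTensor, Nat.cast_sum, Finset.sum_smul]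
      refine Finset.sum_congr rfl fun j _ => ?_
      rw [← LieModule.toEnd_apply_apply k L V, hw j, MultilinearMap.map_update_smul,
        Function.update_eq_self]
    · have h1 : ∀ j, v j ∈ LinearMap.range f := fun j =>
        hw0 j (Finset.sum_eq_zero_iff.1 h0 j (Finset.mem_univ j))
      choose s hs using h1
      exact ⟨pureTensor d i s, by rw [tensorSumMap_pureTensor]; simp only [hs]⟩

end TensorSum

section Main

variable {k : Type u} [Field k] {P : LinearOperad k}

/-! ### Derivations intertwined by homomorphisms of algebras. -/

section Derivations

variable {A B : Type*} [AddCommGroup A] [Module k A] [OperadAlgebra P A] [AddCommGroup B]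
  [Module k B] [OperadAlgebra P B]

theorem IsHom.comp_derivation {f : A →ₗ[k] B} (hf : IsHom P f) {δ : A →ₗ[k] A}
    (hδ : IsDerivation P δ) : IsDerivationAlong P f (f ∘ₗ δ) := by
  intro r p a
  simp only [LinearMap.comp_apply]
  rw [hδ, map_sum]
  refine Finset.sum_congr rfl fun i _ => ?_
  rw [hf]
  congr 1
  funext j
  by_cases h : j = i
  · subst h; simp
  · simp [h]

theorem IsHom.derivation_comp {f : A →ₗ[k] B} (hf : IsHom P f) {δ : B →ₗ[k] B}
    (hδ : IsDerivation P δ) : IsDerivationAlong P f (δ ∘ₗ f) := by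
  intro r p a
  simp only [LinearMap.comp_apply]
  rw [hf, hδ]

/-- Derivations of a free algebra and of an algebra are intertwined by a homomorphism if they are
on the generators. -/
theorem FreeAlg.intertwine {X : Type} {f : FreeAlg P X →ₗ[k] B} (hf : IsHom P f)
    {δ : FreeAlg P X →ₗ[k] FreeAlg P X} (hδ : IsDerivation P δ) {ε : B →ₗ[k] B}
    (hε : IsDerivation P ε) (h : ∀ x, f (δ (FreeAlg.gen P x)) = ε (f (FreeAlg.gen P x)))
    (v : FreeAlg P X) : f (δ v) = ε (f v) :=
  LinearMap.congr_fun
    (FreeAlg.derivation_unique (hf.comp_derivation hδ) (hf.derivation_comp hε) h) v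

end Derivations

/-! ### Restriction to finitely many generators -/

variable (P) in
/-- The retraction `𝐕 → 𝐕_n` that kills `x_i` for `i ≥ n`. -/
def retractV (n : ℕ) : Vinf P →ₗ[k] Vfin P n :=
  FreeAlg.lift (fun i => if h : i < n then FreeAlg.gen P ⟨i, h⟩ else 0)

theorem retractV_isHom (n : ℕ) : IsHom P (retractV P n) := FreeAlg.lift_isHom _

theorem retractV_gen_lt {n i : ℕ} (h : i < n) :
    retractV P n (FreeAlg.gen P i) = FreeAlg.gen P ⟨i, h⟩ := by
  rw [retractV, FreeAlg.lift_gen, dif_pos h]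

theorem retractV_gen_ge {n i : ℕ} (h : n ≤ i) : retractV P n (FreeAlg.gen P i) = 0 := by
  rw [retractV, FreeAlg.lift_gen, dif_neg (not_lt.2 h)]

theorem retractV_comp_inclV (n : ℕ) : retractV P n ∘ₗ inclV P n = LinearMap.id := by
  refine FreeAlg.hom_unique (fun r p a => ?_) (fun r p a => rfl) fun i => ?_
  · simp only [LinearMap.comp_apply]
    rw [inclV_isHom, retractV_isHom]
  · rw [LinearMap.comp_apply, inclV_gen, retractV_gen_lt i.2]
    rfl

section Restriction

variable {ι : Type u} (d : ι → ℕ)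

theorem retract_incl (n : ℕ) (s : TensorSum k (Vfin P n) d) :
    tensorSumMap d (retractV P n) (tensorSumMap d (inclV P n) s) = s := by
  rw [tensorSumMap_comp, retractV_comp_inclV, tensorSumMap_id]

theorem inclH_lie_incl {n : ℕ} (δ : hfin P n) (s : TensorSum k (Vfin P n) d) :
    ⁅inclH P n δ, tensorSumMap d (inclV P n) s⁆ = tensorSumMap d (inclV P n) ⁅δ, s⁆ :=
  (tensorSumMap_lie d (fun v => (extDer_inclV n δ.2 v).symm) s).symm

/-- Derivations that kill `x_i` for `i < n` kill `𝐕_n`. -/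
theorem lie_incl_eq_zero {n : ℕ} {κ : hinf P}
    (hκ : ∀ i, i < n → (κ : Module.End k (Vinf P)) (FreeAlg.gen P i) = 0)
    (s : TensorSum k (Vfin P n) d) : ⁅κ, tensorSumMap d (inclV P n) s⁆ = 0 := by
  -- The vanishing is read as an intertwining: on generators, hence on 𝐕_n and on its tensor powers,
  -- the inclusion carries the zero derivation to `κ`.
  refine (tensorSumMap_lie d (f := inclV P n) (x := (0 : hfin P n)) (y := κ) (fun v => ?_) s).symm.trans
    (by rw [zero_lie, map_zero])
  refine FreeAlg.intertwine (inclV_isHom n) (0 : hfin P n).2 κ.2.1 (fun i => ?_) v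
  rw [inclV_gen, hκ i i.2]
  exact map_zero _

variable (P) in
-- Only finitely many generators occur in a given element. Asking for all large `n` lets finitely
-- many elements share a common level.
theorem exists_incl_eq (t : TensorSum k (Vinf P) d) :
    ∃ m, ∀ n, m ≤ n → ∃ s, tensorSumMap d (inclV P n) s = t := by
  induction t using tensorSum_induction with
  | h0 => exact ⟨0, fun n _ => ⟨0, map_zero _⟩⟩
  | hadd s t hs ht =>
    obtain ⟨m, hm⟩ := hs
    obtain ⟨m', hm'⟩ := ht
    refine ⟨max m m', fun n hn => ?_⟩
    obtain ⟨a, rfl⟩ := hm n (le_trans (le_max_left _ _) hn)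
    obtain ⟨b, rfl⟩ := hm' n (le_trans (le_max_right _ _) hn)
    exact ⟨a + b, map_add _ _ _⟩
  | hsmul c t ht =>
    obtain ⟨m, hm⟩ := ht
    refine ⟨m, fun n hn => ?_⟩
    obtain ⟨a, rfl⟩ := hm n hn
    exact ⟨c • a, map_smul _ _ _⟩
  | hpure i v =>
    choose m hm using fun j => exists_inclV P (v j)
    refine ⟨Finset.univ.sup m, fun n hn => ?_⟩
    choose w hw using fun j => hm j n (le_trans (Finset.le_sup (Finset.mem_univ j)) hn)
    exact ⟨pureTensor d i w, by rw [tensorSumMap_pureTensor]; simp only [hw]⟩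

/-! ### The partial Euler derivation -/

section Euler

variable (P) in
/-- The derivation of `𝐕` given by `x_i ↦ 0` for `i < n` and `x_i ↦ x_i` for `i ≥ n`. -/
def euler (n : ℕ) : derAlg P (Vinf P) :=
  ⟨FreeAlg.extendDer fun i => if i < n then 0 else FreeAlg.gen P i,
    FreeAlg.extendDer_isDerivation _⟩

variable (P) in
/-- The derivation of `𝐕_N` given by `x_i ↦ 0` for `i < n` and `x_i ↦ x_i` for `i ≥ n`. -/
def eulerFin (n N : ℕ) : hfin P N :=
  ⟨FreeAlg.extendDer fun i => if (i : ℕ) < n then 0 else FreeAlg.gen P i,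
    FreeAlg.extendDer_isDerivation _⟩

theorem inclV_eulerFin (n N : ℕ) (v : Vfin P N) :
    inclV P N ((eulerFin P n N : Module.End k (Vfin P N)) v) =
      (euler P n : Module.End k (Vinf P)) (inclV P N v) := by
  refine FreeAlg.intertwine (inclV_isHom N) (eulerFin P n N).2 (euler P n).2 (fun i => ?_) v
  rw [inclV_gen]
  change inclV P N (FreeAlg.extendDer _ _) = FreeAlg.extendDer _ _
  rw [FreeAlg.extendDer_gen, FreeAlg.extendDer_gen]
  split_ifs
  · exact map_zero _
  · rfl

/-- `euler` moves infinitely many generators and so is in general not in 𝔥; on elements involving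
only the first `N` generators it can be replaced by its truncation, which is. -/
theorem euler_lie_incl (n N : ℕ) (s : TensorSum k (Vfin P N) d) :
    ⁅euler P n, tensorSumMap d (inclV P N) s⁆ =
      ⁅inclH P N (eulerFin P n N), tensorSumMap d (inclV P N) s⁆ := by
  rw [inclH_lie_incl]
  exact (tensorSumMap_lie d (inclV_eulerFin n N) s).symm

/-- The extended truncation fixes x_i for n ≤ i < N and kills all other generators. This is the only
element of 𝔤𝔩_{∞-n} against which invariance has to be tested. -/
theorem inclH_eulerFin_mem (n N : ℕ) : inclH P N (eulerFin P n N) ∈ glRest P n := by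
  have h : ∀ i, i < N → extDer P N (eulerFin P n N : Module.End k (Vfin P N)) (FreeAlg.gen P i) =
      if i < n then 0 else FreeAlg.gen P i := by
    intro i hi
    refine (extDer_gen_lt (P := P) N _ ⟨i, hi⟩).trans ?_
    rw [inclV_eulerFin]
    exact FreeAlg.extendDer_gen _ _
  refine ⟨fun i hi => ?_, fun i hi => ?_⟩
  · change extDer P N _ _ = 0
    rcases lt_or_ge i N with hN | hN
    · rw [h i hN, if_pos hi]
    · exact extDer_gen_ge N _ hN
  · change extDer P N _ _ ∈ _
    rcases lt_or_ge i N with hN | hN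
    · rw [h i hN, if_neg (not_lt.2 hi)]
      exact Submodule.subset_span ⟨i, hi, rfl⟩
    · rw [extDer_gen_ge N _ hN]
      exact zero_mem _

variable (P) in
-- The eigenvalue is the degree in the x_i with i ≥ n, additive under operations by the Leibniz
-- rule. Degree 0 forces every argument of an operation to have degree 0, hence to lie in 𝐕_n.
-- Operations of arity 0 fit in as empty sums.
theorem span_natEigenvectors_euler (n : ℕ) :
    Submodule.span k (natEigenvectors (LieModule.toEnd k (derAlg P (Vinf P)) (Vinf P) (euler P n))
      (LinearMap.range (inclV P n))) = ⊤ := by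
  rw [eq_top_iff]
  rintro v -
  induction v using FreeAlg.induct with
  | hgen i =>
    have hi : (euler P n : Module.End k (Vinf P)) (FreeAlg.gen P i) =
        if i < n then 0 else FreeAlg.gen P i := FreeAlg.extendDer_gen _ _
    refine Submodule.subset_span ?_
    rcases lt_or_ge i n with h | h
    · rw [if_pos h] at hi
      exact ⟨0, by simpa using hi, fun _ => ⟨FreeAlg.gen P ⟨i, h⟩, rfl⟩⟩
    · rw [if_neg (not_lt.2 h)] at hi
      exact ⟨1, by simpa using hi, fun h => absurd h one_ne_zero⟩
  | hzero => exact zero_mem _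
  | hadd v w hv hw => exact add_mem hv hw
  | hsmul c v hv => exact Submodule.smul_mem _ _ hv
  | hop r p v hv =>
    refine MultilinearMap.apply_mem_of_forall_mem_span _
      (fun v hv => Submodule.subset_span ?_) v hv
    choose w hw hw0 using hv
    refine ⟨∑ j, w j, ?_, fun h0 => ?_⟩
    · refine ((euler P n).2 r p v).trans ?_
      rw [Nat.cast_sum, Finset.sum_smul]
      refine Finset.sum_congr rfl fun j _ => ?_
      have := hw j
      rw [LieModule.toEnd_apply_apply] at this
      change (euler P n : Module.End k (Vinf P)) (v j) = _ at this
      rw [this, MultilinearMap.map_update_smul, Function.update_eq_self]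
    · have h1 : ∀ j, v j ∈ LinearMap.range (inclV P n) := fun j =>
        hw0 j (Finset.sum_eq_zero_iff.1 h0 j (Finset.mem_univ j))
      choose s hs using h1
      exact ⟨act P p s, by rw [inclV_isHom]; simp only [hs]⟩

end Euler

/-! ### Invariants of subquotients -/

section Invariants

variable {d} {n : ℕ} {A : LieSubmodule k (hinf P) (TensorSum k (Vinf P) d)}
  {M : LieRep k (hinf P)} (q : A →ₗ⁅k, hinf P⁆ M.carrier)

theorem map_incl_mem_invariants (s : TensorSum k (Vfin P n) d)
    (hs : tensorSumMap d (inclV P n) s ∈ A) : q ⟨_, hs⟩ ∈ Invariants P n M := by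
  rw [mem_invariants]
  intro γ hγ
  rw [← LieModuleHom.map_lie,
    show ⁅γ, (⟨_, hs⟩ : A)⁆ = 0 from Subtype.ext (lie_incl_eq_zero d hγ.1 s), map_zero]

/-- Invariants of a quotient of `A` lift to `A ∩ ⨁ 𝐕_n^{⊗ d}`. -/
theorem exists_incl_of_mem_invariants [CharZero k] (hq : Function.Surjective q) {m : M.carrier}
    (hm : m ∈ Invariants P n M) :
    ∃ (s : TensorSum k (Vfin P n) d) (hs : tensorSumMap d (inclV P n) s ∈ A), q ⟨_, hs⟩ = m := by
  obtain ⟨a, rfl⟩ := hq m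
  -- The kernel of `q` is viewed inside the whole sum of tensor powers because `E`, not being given
  -- by an element of 𝔥, is only defined there.
  let B : Submodule k (TensorSum k (Vinf P) d) :=
    (LinearMap.ker (q : A →ₗ[k] M.carrier)).map A.toSubmodule.subtype
  let E := LieModule.toEnd k (derAlg P (Vinf P)) (TensorSum k (Vinf P) d) (euler P n)
  -- The element `γ` depends on `b`: it is the truncation at a level where `b` is defined. This
  -- suffices for `E` to preserve `B` and to send lifts of invariants into `B`.
  have hE : ∀ b : A, ∃ γ ∈ glRest P n, E b = ((⁅γ, b⁆ : A) : TensorSum k (Vinf P) d) := by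
    rintro ⟨b, hb⟩
    obtain ⟨N, hN⟩ := exists_incl_eq P d b
    obtain ⟨s, rfl⟩ := hN N le_rfl
    exact ⟨_, inclH_eulerFin_mem n N, euler_lie_incl d n N s⟩
  have hmem : ∀ b : A, (b : TensorSum k (Vinf P) d) ∈ B ↔ q b = 0 := by
    intro b
    constructor
    · rintro ⟨c, hc, h⟩
      rwa [← show c = b from Subtype.ext h]
    · exact fun h => ⟨b, h, rfl⟩
  have htop : Submodule.span k (natEigenvectors E
      (LinearMap.range (tensorSumMap d (inclV P n)))) = ⊤ :=
    span_natEigenvectors_tensorSum d _ _ (span_natEigenvectors_euler P n)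
  obtain ⟨J, hJ⟩ := exists_mem_addEigenspaces
    (htop ▸ Submodule.mem_top : (a : TensorSum k (Vinf P) d) ∈ _)
  have hR : ∀ r ∈ LinearMap.range (tensorSumMap d (inclV P n)), E r = 0 := by
    rintro _ ⟨s, rfl⟩
    -- Truncation at level N = n, where no generator is left to be fixed.
    exact (euler_lie_incl d n n s).trans (lie_incl_eq_zero d (inclH_eulerFin_mem n n).1 s)
  have hBA : B ≤ A.toSubmodule := by
    rintro _ ⟨b, -, rfl⟩
    exact b.2
  have hEB : ∀ b ∈ B, E b ∈ B := by
    rintro _ ⟨b, hb, rfl⟩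
    obtain ⟨γ, -, h⟩ := hE b
    rw [Submodule.subtype_apply, h, hmem, LieModuleHom.map_lie,
      show q b = 0 from hb, lie_zero]
  have hEa : E a ∈ B := by
    obtain ⟨γ, hγ, h⟩ := hE a
    rw [h, hmem, LieModuleHom.map_lie]
    exact mem_invariants.1 hm γ hγ
  obtain ⟨_, ⟨s, rfl⟩, hs, hsub⟩ :=
    exists_sub_mem_of_mem_addEigenspaces hR hBA hEB J a a.2 hJ hEa
  refine ⟨s, hs, ?_⟩
  have := (hmem (a - ⟨_, hs⟩)).1 hsub
  rw [map_sub, sub_eq_zero] at this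
  exact this.symm

/-- The map from `A₀ ⊆ ⨁ 𝐕_n^{⊗ d}` to the invariants of a quotient of `A ⊇ A₀`. -/
def toInvariants (A₀ : LieSubmodule k (hfin P n) (TensorSum k (Vfin P n) d))
    (hA : ∀ s ∈ A₀, tensorSumMap d (inclV P n) s ∈ A) :
    A₀ →ₗ⁅k, hfin P n⁆ Invariants P n M where
  toFun s := ⟨q ⟨_, hA s s.2⟩, map_incl_mem_invariants q _ _⟩
  map_add' s t := Subtype.ext (by
    refine Eq.trans ?_ (map_add q _ _)
    change q _ = q _
    congr 1
    exact Subtype.ext (map_add (tensorSumMap d (inclV P n)) (s : TensorSum k (Vfin P n) d) t))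
  map_smul' c s := Subtype.ext (by
    refine Eq.trans ?_ (map_smul q c _)
    change q _ = q _
    congr 1
    exact Subtype.ext (map_smul (tensorSumMap d (inclV P n)) c (s : TensorSum k (Vfin P n) d)))
  map_lie' {δ s} := Subtype.ext (by
    refine Eq.trans ?_ (LieModuleHom.map_lie q (inclH P n δ) _)
    change q _ = q _
    congr 1
    exact Subtype.ext (inclH_lie_incl d δ (s : TensorSum k (Vfin P n) d)).symm)

theorem toInvariants_eq_zero {A₀ : LieSubmodule k (hfin P n) (TensorSum k (Vfin P n) d)}
    (hA : ∀ s ∈ A₀, tensorSumMap d (inclV P n) s ∈ A) (s : A₀) :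
    toInvariants q A₀ hA s = 0 ↔ q ⟨_, hA s s.2⟩ = 0 := Subtype.ext_iff

/-- `A₀` is characterized by `hA` instead of being set to `restrictFin n A`, so that in the proof of
essential surjectivity the given submodule itself can take its place. -/
theorem toInvariants_surjective [CharZero k] (hq : Function.Surjective q)
    {A₀ : LieSubmodule k (hfin P n) (TensorSum k (Vfin P n) d)}
    (hA : ∀ s, s ∈ A₀ ↔ tensorSumMap d (inclV P n) s ∈ A) :
    Function.Surjective (toInvariants q A₀ fun s => (hA s).1) := by
  rintro ⟨m, hm⟩
  obtain ⟨s, hs, rfl⟩ := exists_incl_of_mem_invariants q hq hm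
  exact ⟨⟨s, (hA s).2 hs⟩, rfl⟩

/-- The invariants of a quotient of `A` are a quotient of `A ∩ ⨁ 𝐕_n^{⊗ d}`. -/
def quotEquivInvariants [CharZero k] (hq : Function.Surjective q)
    {A₀ : LieSubmodule k (hfin P n) (TensorSum k (Vfin P n) d)}
    (hA : ∀ s, s ∈ A₀ ↔ tensorSumMap d (inclV P n) s ∈ A) (B₀ : LieSubmodule k (hfin P n) A₀)
    (hB : ∀ s, s ∈ B₀ ↔ q ⟨_, (hA s).1 s.2⟩ = 0) :
    (A₀ ⧸ B₀) ≃ₗ⁅k, hfin P n⁆ Invariants P n M :=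
  quotEquivOfSurjective (toInvariants q A₀ fun s => (hA s).1) (toInvariants_surjective q hq hA) B₀
    fun s => (hB s).trans (toInvariants_eq_zero q (fun s => (hA s).1) s).symm

variable (n A) in
/-- The intersection of `A` with `⨁ 𝐕_n^{⊗ d}`. -/
def restrictFin : LieSubmodule k (hfin P n) (TensorSum k (Vfin P n) d) where
  toSubmodule := A.toSubmodule.comap (tensorSumMap d (inclV P n))
  lie_mem {δ s} hs := by
    change tensorSumMap d (inclV P n) ⁅δ, s⁆ ∈ A
    rw [← inclH_lie_incl]
    exact A.lie_mem hs

end Invariants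

/-- The invariants of a polynomial representation form a polynomial representation. -/
theorem polFin_invariants [CharZero k] (n : ℕ) (M : RepPolInf P) :
    polFin P n ((invariantsFunctor P n).obj M) := by
  obtain ⟨M, ι, d, A, B, ⟨e⟩⟩ := M
  let q : A →ₗ⁅k, hinf P⁆ M.carrier := (e : (A ⧸ B) →ₗ⁅k, hinf P⁆ M.carrier).comp
    (LieSubmodule.Quotient.mk' B)
  have hq : Function.Surjective q := e.surjective.comp (LieSubmodule.Quotient.surjective_mk' B)
  have h : ∀ s : TensorSum k (Vfin P n) d, s ∈ restrictFin n A ↔ tensorSumMap d (inclV P n) s ∈ A :=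
    fun _ => Iff.rfl
  let K : LieSubmodule k (hfin P n) (restrictFin n A) :=
    LieModuleHom.ker (toInvariants q (restrictFin n A) fun s => (h s).1)
  exact ⟨ι, d, restrictFin n A, K, ⟨quotEquivInvariants q hq h K fun s =>
    LieModuleHom.mem_ker.trans (toInvariants_eq_zero q (fun s => (h s).1) s)⟩⟩

end Restriction

/-! ### Extension of subrepresentations from `𝔥_n` to `𝔥` -/

section Extension

variable {n : ℕ}

variable (n) in
/-- The derivation that agrees with `δ` on `x_i` for `i < n` and kills `x_i` for `i ≥ n`. -/
def headPart (δ : hinf P) : hinf P :=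
  ⟨FreeAlg.extendDer fun i => if i < n then (δ : Module.End k (Vinf P)) (FreeAlg.gen P i) else 0,
    FreeAlg.extendDer_isDerivation _, n, fun i hi => by
      rw [FreeAlg.extendDer_gen, if_neg (not_lt.2 hi)]⟩

theorem headPart_gen (δ : hinf P) (i : ℕ) :
    (headPart n δ : Module.End k (Vinf P)) (FreeAlg.gen P i) =
      if i < n then (δ : Module.End k (Vinf P)) (FreeAlg.gen P i) else 0 :=
  FreeAlg.extendDer_gen _ _

theorem headPart_gen_ge (δ : hinf P) {i : ℕ} (hi : n ≤ i) :
    (headPart n δ : Module.End k (Vinf P)) (FreeAlg.gen P i) = 0 := by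
  rw [headPart_gen, if_neg (not_lt.2 hi)]

theorem sub_headPart_gen_lt (δ : hinf P) {i : ℕ} (hi : i < n) :
    ((δ - headPart n δ : hinf P) : Module.End k (Vinf P)) (FreeAlg.gen P i) = 0 := by
  change (δ : Module.End k (Vinf P)) (FreeAlg.gen P i) -
    (headPart n δ : Module.End k (Vinf P)) (FreeAlg.gen P i) = 0
  rw [headPart_gen, if_pos hi, sub_self]

variable (n) in
/-- The derivation of `𝐕_n` induced by `δ` along the retraction `𝐕 → 𝐕_n`. -/
def retractH (δ : hinf P) : hfin P n :=
  ⟨FreeAlg.extendDer fun i : Fin n =>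
      retractV P n ((δ : Module.End k (Vinf P)) (FreeAlg.gen P (i : ℕ))),
    FreeAlg.extendDer_isDerivation _⟩

variable {ι : Type u} (d : ι → ℕ)

/-- The retraction kills x_i for i ≥ n, so intertwining on these generators requires δ x_i to
retract to 0; the hypothesis `hδ` ensures this. A derivation sending x_n to x_0, say, would not
descend to 𝐕_n, which is why `headStable` asks for stability under head derivations only. -/
theorem retract_lie {δ : hinf P}
    (hδ : ∀ i, n ≤ i → (δ : Module.End k (Vinf P)) (FreeAlg.gen P i) = 0)
    (t : TensorSum k (Vinf P) d) :
    tensorSumMap d (retractV P n) ⁅δ, t⁆ = ⁅retractH n δ, tensorSumMap d (retractV P n) t⁆ := by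
  refine tensorSumMap_lie d (fun v => ?_) t
  refine FreeAlg.intertwine (retractV_isHom n) δ.2.1 (retractH n δ).2 (fun i => ?_) v
  rcases lt_or_ge i n with h | h
  · rw [retractV_gen_lt h]
    exact (FreeAlg.extendDer_gen (P := P) (fun i : Fin n =>
      retractV P n ((δ : Module.End k (Vinf P)) (FreeAlg.gen P (i : ℕ)))) ⟨i, h⟩).symm
  · rw [retractV_gen_ge h, hδ i h, map_zero, map_zero]

variable {d} (A : LieSubmodule k (hfin P n) (TensorSum k (Vfin P n) d))

/-- The subspaces of `⨁ 𝐕^{⊗ d}` that contain `A ⊆ ⨁ 𝐕_n^{⊗ d}` and are stable under the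
derivations that kill `x_i` for `i ≥ n`. -/
def headStable : Set (Submodule k (TensorSum k (Vinf P) d)) :=
  {W | (∀ s ∈ A, tensorSumMap d (inclV P n) s ∈ W) ∧ ∀ δ : hinf P,
    (∀ i, n ≤ i → (δ : Module.End k (Vinf P)) (FreeAlg.gen P i) = 0) → ∀ w ∈ W, ⁅δ, w⁆ ∈ W}

theorem sInf_headStable_mem : sInf (headStable A) ∈ headStable A :=
  ⟨fun s hs => Submodule.mem_sInf.2 fun _ hW => hW.1 s hs, fun δ hδ w hw =>
    Submodule.mem_sInf.2 fun W hW => hW.2 δ hδ w (Submodule.mem_sInf.1 hw W hW)⟩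

/-- The decomposition `δ = headPart n δ + (δ - headPart n δ)` reduces stability under 𝔥 to tail
derivations, and does so one vector `w` at a time; the pointwise form is needed in
`tail_lie_mem_sInf_headStable`. -/
theorem lie_mem_of_head_of_tail {W : Submodule k (TensorSum k (Vinf P) d)} (hW : W ∈ headStable A)
    {w : TensorSum k (Vinf P) d} (hw : w ∈ W)
    (htail : ∀ κ : hinf P, (∀ i, i < n → (κ : Module.End k (Vinf P)) (FreeAlg.gen P i) = 0) →
      ⁅κ, w⁆ ∈ W) (δ : hinf P) : ⁅δ, w⁆ ∈ W := by
  rw [← add_sub_cancel (headPart n δ) δ, add_lie]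
  exact add_mem (hW.2 _ (fun i hi => headPart_gen_ge δ hi) w hw)
    (htail _ fun i hi => sub_headPart_gen_lt δ hi)

theorem tail_lie_mem_sInf_headStable {κ : hinf P}
    (hκ : ∀ i, i < n → (κ : Module.End k (Vinf P)) (FreeAlg.gen P i) = 0)
    {w : TensorSum k (Vinf P) d} (hw : w ∈ sInf (headStable A)) :
    ⁅κ, w⁆ ∈ sInf (headStable A) := by
  have hS := sInf_headStable_mem A
  -- By minimality it is enough that the vectors sent into the smallest head-stable subspace by all
  -- tail derivations themselves form a head-stable subspace.
  let W : Submodule k (TensorSum k (Vinf P) d) :=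
    { carrier := {w | w ∈ sInf (headStable A) ∧ ∀ κ : hinf P,
        (∀ i, i < n → (κ : Module.End k (Vinf P)) (FreeAlg.gen P i) = 0) →
          ⁅κ, w⁆ ∈ sInf (headStable A)}
      zero_mem' := ⟨zero_mem _, fun κ _ => by rw [lie_zero]; exact zero_mem _⟩
      add_mem' := fun {v w} hv hw => ⟨add_mem hv.1 hw.1, fun κ hκ => by
        rw [lie_add]; exact add_mem (hv.2 κ hκ) (hw.2 κ hκ)⟩
      smul_mem' := fun c w hw => ⟨Submodule.smul_mem _ c hw.1, fun κ hκ => by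
        rw [lie_smul c κ w]; exact Submodule.smul_mem _ c (hw.2 κ hκ)⟩ }
  have hW : W ∈ headStable A := by
    refine ⟨fun s hs => ⟨hS.1 s hs, fun κ hκ => ?_⟩, fun δ hδ w hw =>
      ⟨hS.2 δ hδ w hw.1, fun κ hκ => ?_⟩⟩
    · rw [lie_incl_eq_zero d hκ]
      exact zero_mem _
    · rw [leibniz_lie]
      -- κ δ w = [κ, δ] w + δ κ w. The commutator need be neither head nor tail, but any element of
      -- 𝔥 maps this `w` into the smallest subspace, by splitting it into head and tail.
      exact add_mem (lie_mem_of_head_of_tail A hS hw.1 hw.2 _) (hS.2 δ hδ _ (hw.2 κ hκ))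
  exact (Submodule.mem_sInf.1 hw W hW).2 κ hκ

/-- The `𝔥`-subrepresentation of `⨁ 𝐕^{⊗ d}` generated by `A ⊆ ⨁ 𝐕_n^{⊗ d}`. -/
def extendInf : LieSubmodule k (hinf P) (TensorSum k (Vinf P) d) where
  toSubmodule := sInf (headStable A)
  lie_mem {δ _} hw := lie_mem_of_head_of_tail A (sInf_headStable_mem A) hw
    (fun _ hκ => tail_lie_mem_sInf_headStable A hκ hw) δ

/-- Extending from 𝔥_n to 𝔥 adds nothing inside ⨁ 𝐕_n^{⊗ d}: the preimage of `A` under the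
retraction is head-stable, so it contains the extension, and the retraction is the identity on ⨁
𝐕_n^{⊗ d}. -/
theorem mem_iff_incl_mem_extendInf (s : TensorSum k (Vfin P n) d) :
    s ∈ A ↔ tensorSumMap d (inclV P n) s ∈ extendInf A := by
  refine ⟨fun h => (sInf_headStable_mem A).1 s h, fun h => ?_⟩
  have hW : A.toSubmodule.comap (tensorSumMap d (retractV P n)) ∈ headStable A := by
    refine ⟨fun s hs => ?_, fun δ hδ w hw => ?_⟩
    · rw [Submodule.mem_comap, retract_incl]
      exact hs
    · rw [Submodule.mem_comap, retract_lie d hδ]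
      exact A.lie_mem hw
  have := Submodule.mem_sInf.1 h _ hW
  rwa [Submodule.mem_comap, retract_incl] at this

end Extension

/-- A subquotient `A / B` of `⨁ 𝐕_n^{⊗ d}` is the space of invariants of a polynomial
representation of `𝔥`. -/
theorem exists_quotient_equiv_invariants [CharZero k] {n : ℕ} {ι : Type u} {d : ι → ℕ}
    (A : LieSubmodule k (hfin P n) (TensorSum k (Vfin P n) d))
    (B : LieSubmodule k (hfin P n) A) :
    ∃ M : RepPolInf P, Nonempty ((A ⧸ B) ≃ₗ⁅k, hfin P n⁆ Invariants P n M.obj) := by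
  let B' : LieSubmodule k (hfin P n) (TensorSum k (Vfin P n) d) := B.map A.incl
  have hB' : ∀ s : A, (s : TensorSum k (Vfin P n) d) ∈ B' ↔ s ∈ B := by
    intro s
    constructor
    · rintro ⟨t, ht, h⟩
      rwa [← show t = s from Subtype.ext h]
    · exact fun h => ⟨s, h, rfl⟩
  -- Intersecting with `extendInf A` avoids having to compare the two extensions; only the traces of
  -- both on ⨁ 𝐕_n^{⊗ d} enter the computation of invariants.
  let C : LieSubmodule k (hinf P) (extendInf A) := (extendInf B').comap (extendInf A).incl
  let M : LieRep k (hinf P) := { carrier := extendInf A ⧸ C }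
  let q : extendInf A →ₗ⁅k, hinf P⁆ M.carrier := LieSubmodule.Quotient.mk' C
  have hq : Function.Surjective q := LieSubmodule.Quotient.surjective_mk' C
  have hqC : ∀ w, q w = 0 ↔ (w : TensorSum k (Vinf P) d) ∈ extendInf B' :=
    fun w => LieSubmodule.Quotient.mk_eq_zero C
  refine ⟨⟨M, ι, d, extendInf A, C, ⟨LieModuleEquiv.refl⟩⟩,
    ⟨quotEquivInvariants q hq (mem_iff_incl_mem_extendInf A) B fun s => ?_⟩⟩
  rw [← hB' s, mem_iff_incl_mem_extendInf B']
  exact (hqC ⟨_, (mem_iff_incl_mem_extendInf A _).1 s.2⟩).symm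

/-- Every polynomial representation of `𝔥_n` is the space of invariants of a polynomial
representation of `𝔥`. -/
theorem exists_invariants_equiv [CharZero k] (n : ℕ) (N : RepPolFin P n) :
    ∃ M : RepPolInf P, Nonempty (Invariants P n M.obj ≃ₗ⁅k, hfin P n⁆ N.obj.carrier) := by
  obtain ⟨N, ι, d, A, B, ⟨e⟩⟩ := N
  obtain ⟨M, ⟨f⟩⟩ := exists_quotient_equiv_invariants A B
  exact ⟨M, ⟨f.symm.trans e⟩⟩

/-- Equivalent Lie modules are isomorphic objects of the category of representations. -/
def LieRep.isoOfEquiv {L : Type u} [LieRing L] [LieAlgebra k L] {M N : LieRep k L}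
    (e : M.carrier ≃ₗ⁅k, L⁆ N.carrier) : M ≅ N where
  hom := (e : M.carrier →ₗ⁅k, L⁆ N.carrier)
  inv := (e.symm : N.carrier →ₗ⁅k, L⁆ M.carrier)
  hom_inv_id := LieModuleHom.ext e.symm_apply_apply
  inv_hom_id := LieModuleHom.ext e.apply_symm_apply

end Main

end OperadRep
end

theorem mainTheorem9 {k : Type u} [Field k] [CharZero k] (P : OperadRep.LinearOperad k) (n : ℕ) :
    ∃ h : ∀ M : OperadRep.RepPolInf P,
        OperadRep.polFin P n ((OperadRep.invariantsFunctor P n).obj M),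
      (OperadRep.specialization P n h).EssSurj := by
  refine ⟨OperadRep.polFin_invariants n, ⟨fun N => ?_⟩⟩
  obtain ⟨M, ⟨e⟩⟩ := OperadRep.exists_invariants_equiv n N
  exact ⟨M, ⟨(OperadRep.polFin P n).isoMk (OperadRep.LieRep.isoOfEquiv e)⟩⟩
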